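/- Let $d\ge 1$ and let $\mathcal F=\bigoplus_{k\ge 0}(\mathbb C^d)^{\otimes k}$ be the full Fock space of $\mathbb C^d$, with shifts $S_i\xi=e_i\otimes\xi$ ($1\le i\le d$), where $e_1,\dots,e_d$ is the standard basis of $\mathbb C^d$. Let $(Z_k)_{k\ge 0}$ be a weight sequence: $Z_k\in B((\mathbb C^d)^{\otimes k})$, $Z_0=I$, $\sup_k\|Z_k\|<\infty$, and there is $\varepsilon>0$ with $|Z_k|\ge\varepsilon I$ for all $k\ge 1$. Put $Z=\bigoplus_k Z_k\in B(\mathcal F)$, $W_i=ZS_i$, and let $\mathcal T=C^*(W_1,\dots,W_d)$ be the (unital) $C^*$-algebra generated by the $W_i$. Assume that all $Z_k$ are positive or, more generally, that $S_1,\dots,S_d\in\mathcal T$. Let $P_n$ be the projection of $\mathcal F$ onto $(\mathbb C^d)^{\otimes n}$, let $\gamma_t$ $(t\in\mathbb R)$ be the gauge automorphism $\gamma_t(X)=V_tXV_t^*$ of $B(\mathcal F)$ with $V_t=\sum_n e^{int}P_n$, and set $$\mathcal D=\{X\in\mathcal T:\gamma_t(X)=X\ \ \forall t\},\qquad F=\{X\in\mathcal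 T:\gamma_t(X)=e^{it}X\ \ \forall t\}.$$ Let $q:B(\mathcal F)\to B(\mathcal F)/\mathcal K$ be the quotient map by the ideal $\mathcal K$ of compact operators, and $z=q(Z)$. Suppose that Condition A(1) holds, that is, $\lim_{k\to\infty}\|I_{\mathbb C^d}\otimes Z_k-Z_{k+1}\|=0$. Then there is a $*$-isomorphism $$q(\mathcal D)\;\cong\; M_{d^\infty}\otimes C^*(z),$$ where $M_{d^\infty}$ is the UHF algebra obtained as the $C^*$-direct limit of the algebras $M_{d^n}(\mathbb C)$ under the embeddings $x\mapsto x\otimes 1$, $C^*(z)$ is the unital $C^*$-algebra generated by $z$, and $\otimes$ is the $C^*$-tensor product (unambiguous, as $M_{d^\infty}$ is nuclear). Moreover, every closed two-sided ideal $J$ of $q(\mathcal D)$ is invariant, that is, $q(F)^*\,J\,q(F)\subseteq J$. -/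

import Mathlib

open Filter Topology
open scoped TensorProduct ComplexOrder

noncomputable section

namespace WeightedCuntz

/-! ### C*-seminorms and the C*-algebra they define -/

/-- A C*-seminorm on a unital complex *-algebra. -/
structure CStarSeminorm (A : Type*) [Ring A] [StarRing A] [Algebra ℂ A] extends
    Seminorm ℂ A where
  mul_le' : ∀ a b : A, toFun (a * b) ≤ toFun a * toFun b
  star_mul_self' : ∀ a : A, toFun (star a * a) = toFun a * toFun a

namespace CStarSeminorm

variable {A : Type*} [Ring A] [StarRing A] [Algebra ℂ A]

instance : CoeFun (CStarSeminorm A) (fun _ => A → ℝ) := ⟨fun p => p.toSeminorm⟩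

theorem mul_le (p : CStarSeminorm A) (a b : A) : p (a * b) ≤ p a * p b := p.mul_le' a b

theorem star_mul_self (p : CStarSeminorm A) (a : A) : p (star a * a) = p a * p a :=
  p.star_mul_self' a

theorem le_star (p : CStarSeminorm A) (a : A) : p a ≤ p (star a) := by
  have h : p a * p a ≤ p (star a) * p a := p.star_mul_self a ▸ p.mul_le (star a) a
  rcases (apply_nonneg p.toSeminorm a).eq_or_lt with h0 | h0
  · exact h0 ▸ apply_nonneg p.toSeminorm (star a)
  · exact le_of_mul_le_mul_right h h0

theorem apply_star (p : CStarSeminorm A) (a : A) : p (star a) = p a :=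
  le_antisymm (by simpa using p.le_star (star a)) (p.le_star a)

/-- The algebra `A`, equipped with the seminorm `p`. -/
def Pre (_ : CStarSeminorm A) : Type _ := A

variable (p : CStarSeminorm A)

instance : Ring p.Pre := inferInstanceAs (Ring A)
instance : StarRing p.Pre := inferInstanceAs (StarRing A)
instance : Algebra ℂ p.Pre := inferInstanceAs (Algebra ℂ A)
instance [StarModule ℂ A] : StarModule ℂ p.Pre := inferInstanceAs (StarModule ℂ A)

/-- The seminorm of `p.Pre`, as a group seminorm. -/
def groupSeminorm : AddGroupSeminorm p.Pre where
  toFun := p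
  map_zero' := map_zero p.toSeminorm
  add_le' := map_add_le_add p.toSeminorm
  neg' := map_neg_eq_map p.toSeminorm

instance : SeminormedRing p.Pre :=
  { p.groupSeminorm.toSeminormedAddCommGroup, (inferInstance : Ring p.Pre) with
    norm_mul_le := fun a b => p.mul_le a b }

instance : NormedAlgebra ℂ p.Pre where
  norm_smul_le r x := (map_smul_eq_mul p.toSeminorm r x).le

theorem norm_pre (x : p.Pre) : ‖x‖ = p x := rfl

instance : NormedStarGroup p.Pre where
  norm_star_le a := (p.apply_star a).le

/-- The Hausdorff completion of `A` in the C*-seminorm `p`. -/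
def Completion : Type _ := UniformSpace.Completion p.Pre

instance : NormedRing p.Completion :=
  inferInstanceAs (NormedRing (UniformSpace.Completion p.Pre))

instance : Algebra ℂ p.Completion :=
  inferInstanceAs (Algebra ℂ (UniformSpace.Completion p.Pre))

instance : CompleteSpace p.Completion :=
  inferInstanceAs (CompleteSpace (UniformSpace.Completion p.Pre))

instance : NormedAlgebra ℂ p.Completion where
  norm_smul_le r x := norm_smul_le (β := UniformSpace.Completion p.Pre) r x

/-- The canonical map of `A` into its completion. -/
def toCompletion (a : A) : p.Completion :=
  UniformSpace.Completion.coe' (α := p.Pre) a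

theorem norm_toCompletion (a : A) : ‖p.toCompletion a‖ = p a :=
  UniformSpace.Completion.norm_coe (E := p.Pre) a

theorem denseRange_toCompletion : DenseRange p.toCompletion :=
  UniformSpace.Completion.denseRange_coe (α := p.Pre)

theorem completion_induction {P : p.Completion → Prop} (x : p.Completion)
    (hc : IsClosed {x | P x}) (h : ∀ a : A, P (p.toCompletion a)) : P x :=
  UniformSpace.Completion.induction_on (α := p.Pre) x hc h

theorem toCompletion_mul (a b : A) :
    p.toCompletion (a * b) = p.toCompletion a * p.toCompletion b :=
  UniformSpace.Completion.coe_mul (α := p.Pre) a b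

theorem toCompletion_add (a b : A) :
    p.toCompletion (a + b) = p.toCompletion a + p.toCompletion b :=
  UniformSpace.Completion.coe_add (α := p.Pre) a b

theorem toCompletion_smul (r : ℂ) (a : A) :
    p.toCompletion (r • a) = r • p.toCompletion a :=
  UniformSpace.Completion.coe_smul (X := p.Pre) r a

theorem uniformContinuous_star_pre : UniformContinuous (star : p.Pre → p.Pre) :=
  (starNormedAddGroupHom (E := p.Pre)).uniformContinuous

instance : Star p.Completion := ⟨UniformSpace.Completion.map (star : p.Pre → p.Pre)⟩

theorem continuous_star_completion : Continuous (star : p.Completion → p.Completion) :=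
  UniformSpace.Completion.continuous_map

theorem toCompletion_star (a : A) : p.toCompletion (star a) = star (p.toCompletion a) :=
  (UniformSpace.Completion.map_coe p.uniformContinuous_star_pre a).symm

theorem completion_induction₂ {P : p.Completion → p.Completion → Prop} (x y : p.Completion)
    (hc : IsClosed {x : p.Completion × p.Completion | P x.1 x.2})
    (h : ∀ a b : A, P (p.toCompletion a) (p.toCompletion b)) : P x y :=
  UniformSpace.Completion.induction_on₂ (α := p.Pre) (β := p.Pre) x y hc h

instance : StarRing p.Completion where
  star_involutive x := by
    have hs := p.continuous_star_completion
    refine p.completion_induction (P := fun x => star (star x) = x) x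
      (isClosed_eq (hs.comp hs) continuous_id) fun a => ?_
    rw [← toCompletion_star, ← toCompletion_star, star_star]
  star_mul x y := by
    have hs := p.continuous_star_completion
    refine p.completion_induction₂ (P := fun x y => star (x * y) = star y * star x) x y
      (isClosed_eq (hs.comp continuous_mul)
      ((hs.comp continuous_snd).mul (hs.comp continuous_fst))) fun a b => ?_
    simp only [← toCompletion_star, ← toCompletion_mul, star_mul]
  star_add x y := by
    have hs := p.continuous_star_completion
    refine p.completion_induction₂ (P := fun x y => star (x + y) = star x + star y) x y
      (isClosed_eq (hs.comp continuous_add)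
      ((hs.comp continuous_fst).add (hs.comp continuous_snd))) fun a b => ?_
    simp only [← toCompletion_star, ← toCompletion_add, star_add]

/-- The completion of a unital complex *-algebra in a C*-seminorm is a unital C*-algebra. -/
instance [StarModule ℂ A] : CStarAlgebra p.Completion where
  norm_mul_self_le x := by
    have hs := p.continuous_star_completion
    refine p.completion_induction (P := fun x => ‖x‖ * ‖x‖ ≤ ‖star x * x‖) x
      (isClosed_le (continuous_norm.mul continuous_norm)
      (continuous_norm.comp (hs.mul continuous_id))) fun a => ?_
    simp only [← toCompletion_star, ← toCompletion_mul, norm_toCompletion]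
    exact (p.star_mul_self a).ge
  star_smul r x := by
    have hs := p.continuous_star_completion
    refine p.completion_induction (P := fun x => star (r • x) = star r • star x) x
      (isClosed_eq (hs.comp (continuous_const_smul r))
      ((continuous_const_smul (star r)).comp hs)) fun a => ?_
    simp only [← toCompletion_smul, ← toCompletion_star, star_smul]

end CStarSeminorm

/-! ### Direct limits of sequences of C*-algebras -/

section DirectLimit

variable {A : ℕ → Type*} [∀ n, CStarAlgebra (A n)] (φ : ∀ n, A n →⋆ₐ[ℂ] A (n + 1))

/-- The *-algebra of sequences `(xₙ)` with `xₙ ∈ Aₙ` and `xₙ₊₁ = φₙ(xₙ)` for all large `n`. -/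
def coherentSequences : StarSubalgebra ℂ (∀ n, A n) where
  carrier := {x | ∀ᶠ n in atTop, x (n + 1) = φ n (x n)}
  mul_mem' {x y} hx hy := by
    filter_upwards [hx, hy] with n h1 h2
    simp [h1, h2]
  add_mem' {x y} hx hy := by
    filter_upwards [hx, hy] with n h1 h2
    simp [h1, h2]
  algebraMap_mem' r := Eventually.of_forall fun n => by
    simpa using ((AlgHomClass.commutes (φ n) r)).symm
  star_mem' {x} hx := by
    filter_upwards [hx] with n h
    simp [h, map_star]

theorem tendsto_norm_coherent (x : coherentSequences φ) :
    Tendsto (fun n => ‖x.1 n‖) atTop (𝓝 (limUnder atTop fun n => ‖x.1 n‖)) := by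
  apply tendsto_nhds_limUnder
  obtain ⟨N, hN⟩ := eventually_atTop.1 (show ∀ᶠ n in atTop, x.1 (n + 1) = φ n (x.1 n) from x.2)
  have hanti : Antitone fun n => ‖x.1 (n + N)‖ := antitone_nat_of_succ_le fun n => by
    have h := hN (n + N) (by omega)
    rw [show n + 1 + N = n + N + 1 by omega, h]
    exact NonUnitalStarAlgHom.norm_apply_le (φ (n + N)) _
  refine ⟨_, (tendsto_add_atTop_iff_nat N).1 (tendsto_atTop_ciInf hanti ⟨0, ?_⟩)⟩
  rintro _ ⟨n, rfl⟩
  exact norm_nonneg _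

/-- The C*-seminorm `(xₙ) ↦ lim ‖xₙ‖` on the eventually coherent sequences. -/
def limitSeminorm : CStarSeminorm (coherentSequences φ) where
  toFun x := limUnder atTop fun n => ‖x.1 n‖
  map_zero' := (tendsto_nhds_unique (tendsto_norm_coherent φ 0)
    (by simp))
  add_le' x y := le_of_tendsto_of_tendsto' (tendsto_norm_coherent φ (x + y))
    ((tendsto_norm_coherent φ x).add (tendsto_norm_coherent φ y)) fun n => norm_add_le _ _
  neg' x := by simp
  smul' r x := tendsto_nhds_unique (tendsto_norm_coherent φ (r • x))
    (((tendsto_norm_coherent φ x).const_mul ‖r‖).congr fun n => (norm_smul r (x.1 n)).symm)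
  mul_le' x y := le_of_tendsto_of_tendsto' (tendsto_norm_coherent φ (x * y))
    ((tendsto_norm_coherent φ x).mul (tendsto_norm_coherent φ y)) fun n => norm_mul_le _ _
  star_mul_self' x := tendsto_nhds_unique (tendsto_norm_coherent φ (star x * x))
    (((tendsto_norm_coherent φ x).mul (tendsto_norm_coherent φ x)).congr fun n =>
      (CStarRing.norm_star_mul_self (x := x.1 n)).symm)

/-- The C*-algebraic direct limit of `A₀ → A₁ → A₂ → ⋯`. -/
abbrev CStarDirectLimit : Type _ := (limitSeminorm φ).Completion

end DirectLimit

/-! ### The C*-tensor product -/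

section Tensor

variable (A B : Type*) [CStarAlgebra A] [CStarAlgebra B]

variable {A B} in
theorem CStarSeminorm.tmul_le (p : CStarSeminorm (A ⊗[ℂ] B)) (a : A) (b : B) :
    p (a ⊗ₜ b) ≤ ‖a‖ * ‖b‖ := by
  let f : A →⋆ₙₐ[ℂ] p.Completion :=
    { toFun := fun a => p.toCompletion (a ⊗ₜ 1)
      map_smul' := fun r a => by
        simp [← TensorProduct.smul_tmul', p.toCompletion_smul]
      map_zero' := by
        rw [TensorProduct.zero_tmul]; exact UniformSpace.Completion.coe_zero (α := p.Pre)
      map_add' := fun a a' => by rw [TensorProduct.add_tmul, p.toCompletion_add]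
      map_mul' := fun a a' => by rw [← p.toCompletion_mul]; simp
      map_star' := fun a => by rw [← p.toCompletion_star]; simp }
  let g : B →⋆ₙₐ[ℂ] p.Completion :=
    { toFun := fun b => p.toCompletion (1 ⊗ₜ b)
      map_smul' := fun r b => by
        simp [TensorProduct.tmul_smul, p.toCompletion_smul]
      map_zero' := by
        rw [TensorProduct.tmul_zero]; exact UniformSpace.Completion.coe_zero (α := p.Pre)
      map_add' := fun a a' => by rw [TensorProduct.tmul_add, p.toCompletion_add]
      map_mul' := fun a a' => by rw [← p.toCompletion_mul]; simp
      map_star' := fun a => by rw [← p.toCompletion_star]; simp }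
  have hf : p (a ⊗ₜ 1) ≤ ‖a‖ := by
    have := NonUnitalStarAlgHom.norm_apply_le f a
    rwa [show f a = p.toCompletion (a ⊗ₜ 1) from rfl, p.norm_toCompletion] at this
  have hg : p (1 ⊗ₜ b) ≤ ‖b‖ := by
    have := NonUnitalStarAlgHom.norm_apply_le g b
    rwa [show g b = p.toCompletion (1 ⊗ₜ b) from rfl, p.norm_toCompletion] at this
  calc p (a ⊗ₜ b) = p ((a ⊗ₜ 1) * (1 ⊗ₜ b)) := by simp
    _ ≤ p (a ⊗ₜ 1) * p (1 ⊗ₜ b) := p.mul_le _ _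
    _ ≤ ‖a‖ * ‖b‖ := mul_le_mul hf hg (apply_nonneg _ _) (norm_nonneg _)

variable {A B} in
theorem bddAbove_cstarSeminorms (x : A ⊗[ℂ] B) :
    BddAbove (Set.range fun p : CStarSeminorm (A ⊗[ℂ] B) => p x) := by
  induction x with
  | zero => exact ⟨0, by rintro _ ⟨p, rfl⟩; exact (map_zero p.toSeminorm).le⟩
  | tmul a b => exact ⟨‖a‖ * ‖b‖, by rintro _ ⟨p, rfl⟩; exact p.tmul_le a b⟩
  | add x y hx hy =>
    obtain ⟨C, hC⟩ := hx
    obtain ⟨D, hD⟩ := hy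
    refine ⟨C + D, ?_⟩
    rintro _ ⟨p, rfl⟩
    exact (map_add_le_add p.toSeminorm x y).trans (add_le_add (hC ⟨p, rfl⟩) (hD ⟨p, rfl⟩))

instance (A : Type*) [Ring A] [StarRing A] [Algebra ℂ A] : Nonempty (CStarSeminorm A) :=
  ⟨{ toSeminorm := 0,
      mul_le' := fun _ _ => (zero_mul (0 : ℝ)).ge,
      star_mul_self' := fun _ => (zero_mul (0 : ℝ)).symm }⟩

/-- The largest C*-seminorm on the algebraic tensor product of two C*-algebras. -/
def tensorSeminorm : CStarSeminorm (A ⊗[ℂ] B) where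
  toFun x := ⨆ p : CStarSeminorm (A ⊗[ℂ] B), p x
  map_zero' := by simp
  add_le' x y := ciSup_le fun p => (map_add_le_add p.toSeminorm x y).trans
    (add_le_add (le_ciSup (bddAbove_cstarSeminorms x) p) (le_ciSup (bddAbove_cstarSeminorms y) p))
  neg' x := by simp
  smul' r x := by
    simp only [map_smul_eq_mul]
    exact (Real.mul_iSup_of_nonneg (norm_nonneg r) _).symm
  mul_le' x y := ciSup_le fun p => (p.mul_le x y).trans
    (mul_le_mul (le_ciSup (bddAbove_cstarSeminorms x) p) (le_ciSup (bddAbove_cstarSeminorms y) p)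
      (apply_nonneg _ _) (Real.iSup_nonneg fun p => apply_nonneg _ _))
  star_mul_self' x := by
    have h0 : 0 ≤ ⨆ p : CStarSeminorm (A ⊗[ℂ] B), p x := Real.iSup_nonneg fun p => apply_nonneg _ _
    refine le_antisymm (ciSup_le fun p => ?_) ?_
    · have h := le_ciSup (bddAbove_cstarSeminorms x) p
      rw [p.star_mul_self]
      exact mul_le_mul h h (apply_nonneg _ _) h0
    · rw [Real.mul_iSup_of_nonneg h0]
      refine ciSup_le fun p => ?_
      rw [Real.iSup_mul_of_nonneg (apply_nonneg _ _)]
      refine ciSup_le fun q => ?_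
      have hb := bddAbove_cstarSeminorms (star x * x)
      rcases le_total (p x) (q x) with h | h
      · refine le_trans ?_ (le_ciSup hb q)
        rw [q.star_mul_self]
        exact mul_le_mul_of_nonneg_left h (apply_nonneg _ _)
      · refine le_trans ?_ (le_ciSup hb p)
        rw [p.star_mul_self]
        exact mul_le_mul_of_nonneg_right h (apply_nonneg _ _)

/-- The C*-tensor product of `A` and `B`: the completion of the algebraic tensor product in its
largest C*-seminorm. When one of the factors is nuclear, as is every UHF algebra, the algebraic
tensor product carries only one C*-norm, so that this is also the spatial tensor product. -/
abbrev CStarTensor : Type _ := (tensorSeminorm A B).Completion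

end Tensor

/-! ### The UHF algebra of type `d^∞` -/

/-- The algebra `M_{dⁿ}(ℂ)`, with rows and columns indexed by the words of length `n`. -/
abbrev MatrixLevel (d n : ℕ) : Type := CStarMatrix (Fin n → Fin d) (Fin n → Fin d) ℂ

/-- The matrix `x ⊗ 1` in `M_{dⁿ⁺¹}`, for `x` in `M_{dⁿ}`. -/
def matrixTensorOne {d n : ℕ} (x : MatrixLevel d n) : MatrixLevel d (n + 1) :=
  CStarMatrix.ofMatrix fun α β =>
    if α (Fin.last n) = β (Fin.last n) then x (Fin.init α) (Fin.init β) else 0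

theorem matrixTensorOne_apply {d n : ℕ} (x : MatrixLevel d n) (α β : Fin (n + 1) → Fin d) :
    matrixTensorOne x α β =
      if α (Fin.last n) = β (Fin.last n) then x (Fin.init α) (Fin.init β) else 0 := rfl

theorem matrixTensorOne_one {d n : ℕ} :
    matrixTensorOne (1 : MatrixLevel d n) = 1 := by
  ext α β
  simp only [matrixTensorOne_apply, CStarMatrix.one_apply]
  have h : α = β ↔ Fin.init α = Fin.init β ∧ α (Fin.last n) = β (Fin.last n) := by
    conv_lhs => rw [← Fin.snoc_init_self α, ← Fin.snoc_init_self β]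
    exact Fin.snoc_inj
  simp only [h]
  split_ifs <;> simp_all

/-- The embedding `x ↦ x ⊗ 1` of `M_{dⁿ}` into `M_{dⁿ⁺¹}`, that is `e_{α,β} ↦ ∑ᵢ e_{αi,βi}`. -/
def matrixEmbedding (d n : ℕ) : MatrixLevel d n →⋆ₐ[ℂ] MatrixLevel d (n + 1) where
  toFun := matrixTensorOne
  map_one' := matrixTensorOne_one
  map_mul' x y := by
    ext α β
    simp only [matrixTensorOne_apply, CStarMatrix.mul_apply]
    rw [← (Fin.snocEquiv fun _ => Fin d).sum_comp, Fintype.sum_prod_type]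
    simp only [Fin.snocEquiv, Equiv.coe_fn_mk, Fin.snoc_last, Fin.init_snoc]
    rw [Finset.sum_eq_single (α (Fin.last n))]
    · simp only [if_true]
      split_ifs <;> simp
    · intro i _ hi
      simp [Ne.symm hi]
    · simp
  map_zero' := by
    ext α β
    simp [matrixTensorOne_apply]
  map_add' x y := by
    ext α β
    simp only [matrixTensorOne_apply, CStarMatrix.add_apply]
    split_ifs <;> simp
  commutes' r := by
    have h : ∀ x : MatrixLevel d n, matrixTensorOne (r • x) = r • matrixTensorOne x := fun x => by
      ext α β
      simp only [matrixTensorOne_apply, CStarMatrix.smul_apply]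
      split_ifs <;> simp
    simp only [Algebra.algebraMap_eq_smul_one, h, matrixTensorOne_one]
  map_star' x := by
    ext α β
    simp only [matrixTensorOne_apply, CStarMatrix.star_apply]
    by_cases h : α (Fin.last n) = β (Fin.last n)
    · simp [h]
    · simp [h, Ne.symm h]

/-- The UHF algebra `M_{d^∞}`, the direct limit of the algebras `M_{dⁿ}(ℂ)`. -/
abbrev UHF (d : ℕ) : Type := CStarDirectLimit (matrixEmbedding d)

/-! ### The Calkin algebra -/

section Calkin

variable (H : Type*) [NormedAddCommGroup H] [InnerProductSpace ℂ H] [CompleteSpace H]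

variable {H} in
theorem exists_projection_approx {T : H →L[ℂ] H} (hT : IsCompactOperator T) {ε : ℝ} (hε : 0 < ε) :
    ∃ E : H →L[ℂ] H, IsCompactOperator E ∧ star E = E ∧ ‖1 - E‖ ≤ 1 ∧ ‖(1 - E) * T‖ ≤ ε := by
  have hc := (hT.isCompact_closure_image_closedBall (f := (T : H →ₗ[ℂ] H)) 1).totallyBounded
  obtain ⟨t, ht, hcov⟩ := Metric.totallyBounded_iff.1 hc ε hε
  let U : Submodule ℂ H := Submodule.span ℂ t
  have : FiniteDimensional ℂ U := FiniteDimensional.span_of_finite ℂ ht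
  have hn : ‖1 - U.starProjection‖ ≤ 1 := by
    have h : (1 : H →L[ℂ] H) - U.starProjection = Uᗮ.starProjection := by
      rw [Submodule.starProjection_orthogonal]; rfl
    rw [h]; exact Submodule.starProjection_norm_le _
  refine ⟨U.starProjection, ?_, ?_, hn, ?_⟩
  · have : LocallyCompactSpace U := by
      have : ProperSpace U := FiniteDimensional.proper ℂ U
      infer_instance
    have : IsCompactOperator (U.orthogonalProjectionOnto : H →L[ℂ] U) :=
      isCompactOperator_of_locallyCompactSpace_dom U.orthogonalProjectionOnto
    exact this.clm_comp U.subtypeL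
  · exact isSelfAdjoint_starProjection U
  · refine ContinuousLinearMap.opNorm_le_of_unit_norm hε.le fun x hx => ?_
    have hmem : T x ∈ closure (T '' Metric.closedBall 0 1) :=
      subset_closure ⟨x, by simp [hx], rfl⟩
    obtain ⟨y, hy, hxy⟩ := Set.mem_iUnion₂.1 (hcov hmem)
    have hyU : U.starProjection y = y :=
      Submodule.starProjection_eq_self_iff.2 (Submodule.subset_span hy)
    have heq : ((1 - U.starProjection) * T) x = (1 - U.starProjection) (T x - y) := by
      simp [hyU]
    rw [heq]
    refine ((1 - U.starProjection).le_opNorm _).trans ?_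
    rw [Metric.mem_ball, dist_eq_norm] at hxy
    nlinarith [norm_nonneg (T x - y)]

variable {H} in
theorem IsCompactOperator.star_mem {T : H →L[ℂ] H} (hT : IsCompactOperator T) :
    IsCompactOperator (star T : H →L[ℂ] H) := by
  have hcl : IsClosed {f : H →L[ℂ] H | IsCompactOperator f} :=
    isClosed_setOfPred_isCompactOperator
  refine hcl.closure_subset (Metric.mem_closure_iff.2 fun ε hε => ?_)
  obtain ⟨E, hE, hEs, -, hET⟩ := exists_projection_approx hT (half_pos hε)
  refine ⟨star T * E, hE.clm_comp (star T), ?_⟩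
  rw [dist_eq_norm]
  have : star T - star T * E = star ((1 - E) * T) := by
    simp [star_mul, hEs, mul_sub]
  rw [this, norm_star]
  linarith

/-- The ideal `𝒦` of compact operators in `B(H)`. -/
def compactIdeal : Ideal (H →L[ℂ] H) where
  carrier := {T | IsCompactOperator T}
  add_mem' h h' := h.add h'
  zero_mem' := isCompactOperator_zero
  smul_mem' S _ h := h.clm_comp S

instance : (compactIdeal H).IsTwoSided where
  mul_mem_of_left S h := IsCompactOperator.comp_clm h S

instance : IsClosed (compactIdeal H : Set (H →L[ℂ] H)) := isClosed_setOfPred_isCompactOperator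

/-- The Calkin algebra `B(H)/𝒦`. -/
def Calkin : Type _ := (H →L[ℂ] H) ⧸ compactIdeal H

instance : Ring (Calkin H) := inferInstanceAs (Ring ((H →L[ℂ] H) ⧸ compactIdeal H))

instance : Algebra ℂ (Calkin H) := inferInstanceAs (Algebra ℂ ((H →L[ℂ] H) ⧸ compactIdeal H))

/-- The quotient map, as a homomorphism of algebras. -/
def calkinMk : (H →L[ℂ] H) →ₐ[ℂ] Calkin H := Ideal.Quotient.mkₐ ℂ (compactIdeal H)

theorem calkinMk_surjective {H : Type*} [NormedAddCommGroup H] [InnerProductSpace ℂ H] : Function.Surjective (calkinMk H) := Ideal.Quotient.mk_surjective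

theorem calkinMk_eq_iff {H : Type*} [NormedAddCommGroup H] [InnerProductSpace ℂ H]
    {S T : H →L[ℂ] H} :
    calkinMk H S = calkinMk H T ↔ IsCompactOperator (S - T) :=
  Ideal.Quotient.eq

instance : Star (Calkin H) where
  star := Quotient.map' (s₁ := _) (s₂ := _) star fun S T h => by
    have h' : S - T ∈ compactIdeal H := (Submodule.quotientRel_def _).1 h
    refine (Submodule.quotientRel_def _).2 ?_
    rw [← star_sub]
    exact IsCompactOperator.star_mem h'

variable {H} in
theorem calkinMk_star (T : H →L[ℂ] H) : calkinMk H (star T) = star (calkinMk H T) := rfl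

instance : StarRing (Calkin H) where
  star_involutive x := by
    obtain ⟨S, rfl⟩ := calkinMk_surjective x
    rw [← calkinMk_star, ← calkinMk_star, star_star]
  star_mul x y := by
    obtain ⟨S, rfl⟩ := calkinMk_surjective x
    obtain ⟨T, rfl⟩ := calkinMk_surjective y
    simp only [← calkinMk_star, ← map_mul, star_mul]
  star_add x y := by
    obtain ⟨S, rfl⟩ := calkinMk_surjective x
    obtain ⟨T, rfl⟩ := calkinMk_surjective y
    simp only [← calkinMk_star, ← map_add, star_add]

instance : StarModule ℂ (Calkin H) where
  star_smul r x := by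
    obtain ⟨S, rfl⟩ := calkinMk_surjective x
    simp only [← calkinMk_star, ← map_smul, star_smul]

instance : NormedAddCommGroup (Calkin H) :=
  inferInstanceAs (NormedAddCommGroup ((H →L[ℂ] H) ⧸ compactIdeal H))

variable {H} in
theorem norm_calkinMk_le (T : H →L[ℂ] H) : ‖calkinMk H T‖ ≤ ‖T‖ :=
  Submodule.Quotient.norm_mk_le (compactIdeal H) T

variable {H} in
theorem exists_lift_norm_lt (x : Calkin H) {ε : ℝ} (hε : 0 < ε) :
    ∃ T, calkinMk H T = x ∧ ‖T‖ < ‖x‖ + ε :=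
  Submodule.Quotient.norm_mk_lt (S := compactIdeal H) x hε

instance : NormedRing (Calkin H) where
  __ : NormedAddCommGroup (Calkin H) := inferInstance
  __ : Ring (Calkin H) := inferInstance
  norm_mul_le x y := by
    refine le_of_forall_pos_le_add fun ε hε => ?_
    have hcont : Tendsto (fun δ : ℝ => (‖x‖ + δ) * (‖y‖ + δ)) (𝓝[>] 0) (𝓝 (‖x‖ * ‖y‖)) := by
      have : Continuous fun δ : ℝ => (‖x‖ + δ) * (‖y‖ + δ) := by fun_prop
      simpa using (this.tendsto 0).mono_left nhdsWithin_le_nhds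
    obtain ⟨δ, hδ, hδ0⟩ := ((hcont.eventually (gt_mem_nhds
      (lt_add_of_pos_right (‖x‖ * ‖y‖) hε))).and self_mem_nhdsWithin).exists
    obtain ⟨S, rfl, hS⟩ := exists_lift_norm_lt x hδ0
    obtain ⟨T, rfl, hT⟩ := exists_lift_norm_lt y hδ0
    rw [← map_mul]
    refine ((norm_calkinMk_le _).trans (norm_mul_le S T)).trans (le_trans ?_ hδ.le)
    exact mul_le_mul hS.le hT.le (norm_nonneg _) ((norm_nonneg _).trans hS.le)

instance : NormedAlgebra ℂ (Calkin H) where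
  norm_smul_le r x := norm_smul_le (β := (H →L[ℂ] H) ⧸ compactIdeal H) r x

instance : CompleteSpace (Calkin H) :=
  inferInstanceAs (CompleteSpace ((H →L[ℂ] H) ⧸ compactIdeal H))

/-- The Calkin algebra is a C*-algebra. -/
instance : CStarAlgebra (Calkin H) where
  norm_mul_self_le x := by
    obtain ⟨T, rfl⟩ := calkinMk_surjective x
    refine le_of_forall_pos_le_add fun ε hε => ?_
    obtain ⟨R, hR, hRn⟩ := exists_lift_norm_lt (star (calkinMk H T) * calkinMk H T) (half_pos hε)
    rw [← calkinMk_star, ← map_mul] at hR hRn ⊢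
    have hK : IsCompactOperator (star T * T - R : H →L[ℂ] H) := calkinMk_eq_iff.1 hR.symm
    obtain ⟨E, hE, hEs, hE1, hEK⟩ := exists_projection_approx hK (half_pos hε)
    have hq : calkinMk H T = calkinMk H (T * (1 - E)) := by
      rw [calkinMk_eq_iff]
      have : T - T * (1 - E) = T * E := by rw [mul_sub, mul_one, sub_sub_cancel]
      rw [this]
      exact hE.clm_comp T
    have h1 : ‖calkinMk H T‖ ≤ ‖T * (1 - E)‖ := hq ▸ norm_calkinMk_le _
    have h2 : ‖T * (1 - E)‖ * ‖T * (1 - E)‖ = ‖(1 - E) * R * (1 - E) +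
        (1 - E) * (star T * T - R) * (1 - E)‖ := by
      rw [← CStarRing.norm_star_mul_self]
      congr 1
      simp only [star_mul, star_sub, star_one, hEs]
      noncomm_ring
    have h3 : ‖(1 - E) * R * (1 - E)‖ ≤ ‖R‖ := by
      have a := norm_mul_le ((1 - E) * R) (1 - E)
      have b := norm_mul_le (1 - E) R
      nlinarith [norm_nonneg R, norm_nonneg (1 - E), norm_nonneg ((1 - E) * R)]
    have h4 : ‖(1 - E) * (star T * T - R) * (1 - E)‖ ≤ ε / 2 := by
      have a := norm_mul_le ((1 - E) * (star T * T - R)) (1 - E)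
      nlinarith [norm_nonneg ((1 - E) * (star T * T - R)), norm_nonneg (1 - E)]
    have h5 := norm_add_le ((1 - E) * R * (1 - E)) ((1 - E) * (star T * T - R) * (1 - E))
    have h6 := mul_le_mul h1 h1 (norm_nonneg _) (norm_nonneg _)
    linarith

/-- The quotient map `q : B(H) → B(H)/𝒦`. -/
def calkinMap : (H →L[ℂ] H) →⋆ₐ[ℂ] Calkin H where
  __ := calkinMk H
  map_star' := calkinMk_star

end Calkin
/-! ### The Fock space and its operators -/

section FockSpace

/-- The Hilbert space `(ℂᵈ)^{⊗k}`, in coordinates with respect to the orthonormal basis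
`e_{α₁} ⊗ ⋯ ⊗ e_{αₖ}` indexed by the words `α` of length `k`. -/
abbrev Level (d k : ℕ) : Type := EuclideanSpace ℂ (Fin k → Fin d)

/-- The full Fock space `ℱ(ℂᵈ) = ⨁ₖ (ℂᵈ)^{⊗k}` (Hilbert space direct sum). -/
abbrev Fock (d : ℕ) : Type := lp (fun k : ℕ => Level d k) 2

variable {d : ℕ}

/-- The vector `eᵢ ⊗ ξ`, for `ξ ∈ (ℂᵈ)^{⊗k}`. -/
def basisTensor (i : Fin d) {k : ℕ} (ξ : Level d k) : Level d (k + 1) :=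
  WithLp.toLp 2 fun α => if α 0 = i then ξ (Fin.tail α) else 0

theorem basisTensor_apply (i : Fin d) {k : ℕ} (ξ : Level d k) (α : Fin (k + 1) → Fin d) :
    basisTensor i ξ α = if α 0 = i then ξ (Fin.tail α) else 0 := rfl

theorem norm_basisTensor (i : Fin d) {k : ℕ} (ξ : Level d k) : ‖basisTensor i ξ‖ = ‖ξ‖ := by
  rw [EuclideanSpace.norm_eq, EuclideanSpace.norm_eq]
  congr 1
  rw [← (Fin.consEquiv fun _ => Fin d).sum_comp, Fintype.sum_prod_type,
    Finset.sum_eq_single i]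
  · simp [basisTensor_apply, Fin.consEquiv]
  · intro j _ hj
    simp [basisTensor_apply, Fin.consEquiv, hj]
  · simp

/-- The components of `Sᵢ ξ`. -/
def shiftFun (i : Fin d) (ξ : ∀ k, Level d k) : ∀ k, Level d k
  | 0 => 0
  | k + 1 => basisTensor i (ξ k)

theorem hasSum_shiftFun (i : Fin d) (ξ : Fock d) :
    HasSum (fun k => ‖shiftFun i (fun k => ξ k) k‖ ^ (2 : ENNReal).toReal)
      (‖ξ‖ ^ (2 : ENNReal).toReal) := by
  rw [← hasSum_nat_add_iff' 1]
  simpa [shiftFun, norm_basisTensor] using lp.hasSum_norm (p := 2) (by simp) ξ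

/-- The (unweighted) shift `Sᵢ`, with `Sᵢ(ξ₁ ⊗ ⋯ ⊗ ξₙ) = eᵢ ⊗ ξ₁ ⊗ ⋯ ⊗ ξₙ`. -/
def shift (i : Fin d) : Fock d →L[ℂ] Fock d :=
  LinearMap.mkContinuous
    { toFun := fun ξ => ⟨shiftFun i (fun k => ξ k), memℓp_gen (hasSum_shiftFun i ξ).summable⟩
      map_add' := fun ξ η => by
        ext k α
        cases k with
        | zero => exact (add_zero (0 : ℂ)).symm
        | succ k =>
          simp only [shiftFun, basisTensor_apply, lp.coeFn_add, Pi.add_apply, PiLp.add_apply]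
          split_ifs <;> simp
      map_smul' := fun r ξ => by
        ext k α
        cases k with
        | zero => simp [shiftFun]
        | succ k =>
          simp only [shiftFun, basisTensor_apply, lp.coeFn_smul, Pi.smul_apply, PiLp.smul_apply,
            RingHom.id_apply]
          split_ifs <;> simp }
    1 fun ξ => by
      rw [one_mul]
      refine lp.norm_le_of_tsum_le (p := 2) (by simp) (norm_nonneg _) ?_
      exact (hasSum_shiftFun i ξ).tsum_eq.le

/-- The operator `A₀ ⊕ A₁ ⊕ A₂ ⊕ ⋯` on the Fock space, for a bounded sequence of operators `Aₖ`
on the spaces `(ℂᵈ)^{⊗k}`. -/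
def diagonal (A : ∀ k, Level d k →L[ℂ] Level d k) (hA : ∃ C : ℝ, ∀ k, ‖A k‖ ≤ C) :
    Fock d →L[ℂ] Fock d :=
  lp.mapCLM 2 A (K := hA.choose) ((norm_nonneg _).trans (hA.choose_spec 0)) hA.choose_spec

theorem diagonal_apply (A : ∀ k, Level d k →L[ℂ] Level d k) (hA : ∃ C : ℝ, ∀ k, ‖A k‖ ≤ C)
    (ξ : Fock d) (k : ℕ) : diagonal A hA ξ k = A k (ξ k) := rfl

/-- The operator `W_t = ∑ₙ e^{int} Pₙ`, where `Pₙ` is the projection of the Fock space onto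
`(ℂᵈ)^{⊗n}`. -/
def gaugeOperator (d : ℕ) (t : ℝ) : Fock d →L[ℂ] Fock d :=
  diagonal (fun n => Complex.exp (Complex.I * n * t) • 1) ⟨1, fun n => by
    refine (norm_smul_le (Complex.exp (Complex.I * n * t)) (1 : Level d n →L[ℂ] Level d n)).trans ?_
    have h : ‖Complex.exp (Complex.I * n * t)‖ = 1 := by
      rw [Complex.norm_exp]; simp
    rw [h, one_mul]
    exact ContinuousLinearMap.norm_id_le⟩

theorem gaugeOperator_apply (t : ℝ) (ξ : Fock d) (n : ℕ) :
    gaugeOperator d t ξ n = Complex.exp (Complex.I * n * t) • ξ n := rfl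

theorem star_gaugeOperator (t : ℝ) : star (gaugeOperator d t) = gaugeOperator d (-t) := by
  rw [ContinuousLinearMap.star_eq_adjoint, eq_comm, ContinuousLinearMap.eq_adjoint_iff]
  intro ξ η
  rw [lp.inner_eq_tsum, lp.inner_eq_tsum]
  refine tsum_congr fun n => ?_
  rw [gaugeOperator_apply, gaugeOperator_apply, inner_smul_left, inner_smul_right,
    ← Complex.exp_conj]
  simp

theorem gaugeOperator_mul (s t : ℝ) (h : s + t = 0) :
    gaugeOperator d s * gaugeOperator d t = 1 := by
  ext1 ξ
  apply lp.ext
  funext n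
  change gaugeOperator d s (gaugeOperator d t ξ) n = ξ n
  have h' : (s : ℂ) + t = 0 := by exact_mod_cast h
  rw [gaugeOperator_apply, gaugeOperator_apply, smul_smul, ← Complex.exp_add, ← mul_add, h',
    mul_zero, Complex.exp_zero, one_smul]

/-- The gauge automorphism `γ_t = Ad W_t`, that is `γ_t(X) = W_t X W_t*`. -/
def gauge (d : ℕ) (t : ℝ) (X : Fock d →L[ℂ] Fock d) : Fock d →L[ℂ] Fock d :=
  gaugeOperator d t * X * star (gaugeOperator d t)

theorem gauge_add (t : ℝ) (X Y : Fock d →L[ℂ] Fock d) :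
    gauge d t (X + Y) = gauge d t X + gauge d t Y := by
  simp only [gauge, mul_add, add_mul]

theorem gauge_mul (t : ℝ) (X Y : Fock d →L[ℂ] Fock d) :
    gauge d t (X * Y) = gauge d t X * gauge d t Y := by
  have h : star (gaugeOperator d t) * gaugeOperator d t = 1 := by
    rw [star_gaugeOperator]
    exact gaugeOperator_mul _ _ (by ring)
  calc gauge d t (X * Y)
      = gaugeOperator d t * X * 1 * Y * star (gaugeOperator d t) := by
        simp only [gauge, mul_assoc, one_mul]
    _ = _ := by rw [← h]; simp only [gauge, mul_assoc]

theorem gauge_smul (t : ℝ) (r : ℂ) (X : Fock d →L[ℂ] Fock d) :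
    gauge d t (r • X) = r • gauge d t X := by
  simp only [gauge, mul_smul_comm, smul_mul_assoc]

theorem gauge_one (t : ℝ) : gauge d t 1 = 1 := by
  rw [gauge, star_gaugeOperator, mul_one]
  exact gaugeOperator_mul _ _ (by ring)

theorem gauge_star (t : ℝ) (X : Fock d →L[ℂ] Fock d) :
    gauge d t (star X) = star (gauge d t X) := by
  simp only [gauge, star_mul, star_star, mul_assoc]

/-- The operator `I ⊗ T` on `ℂᵈ ⊗ (ℂᵈ)^{⊗k}`, for an operator `T` on `(ℂᵈ)^{⊗k}`; it maps
`eᵢ ⊗ ξ` to `eᵢ ⊗ Tξ`. -/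
def oneTensor {k : ℕ} (T : Level d k →L[ℂ] Level d k) :
    Level d (k + 1) →L[ℂ] Level d (k + 1) :=
  LinearMap.toContinuousLinearMap
    { toFun := fun ξ => WithLp.toLp 2 fun α =>
        T (WithLp.toLp 2 fun β => ξ (Fin.cons (α 0) β)) (Fin.tail α)
      map_add' := fun ξ η => by
        ext α
        simp only [PiLp.add_apply]
        rw [← PiLp.add_apply, ← map_add]
        rfl
      map_smul' := fun r ξ => by
        ext α
        simp only [PiLp.smul_apply, RingHom.id_apply]
        rw [← PiLp.smul_apply, ← map_smul]
        rfl }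

theorem oneTensor_basisTensor {k : ℕ} (T : Level d k →L[ℂ] Level d k) (i : Fin d)
    (ξ : Level d k) : oneTensor T (basisTensor i ξ) = basisTensor i (T ξ) := by
  ext α
  change T (WithLp.toLp 2 fun β => basisTensor i ξ (Fin.cons (α 0) β)) (Fin.tail α) = _
  simp only [basisTensor_apply, Fin.cons_zero, Fin.tail_cons]
  split_ifs
  · rfl
  · change T 0 (Fin.tail α) = 0
    simp

/-- The operator `I_p ⊗ T` on `(ℂᵈ)^{⊗p} ⊗ (ℂᵈ)^{⊗k} = (ℂᵈ)^{⊗(k+p)}`. -/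
def idTensor {k : ℕ} (T : Level d k →L[ℂ] Level d k) :
    (p : ℕ) → (Level d (k + p) →L[ℂ] Level d (k + p))
  | 0 => T
  | p + 1 => oneTensor (idTensor T p)

end FockSpace

/-! ### Weighted shifts and their algebras -/

/-- A weight sequence. -/
structure WeightSequence (d : ℕ) where
  /-- The operator `Zₖ` on `(ℂᵈ)^{⊗k}`. -/
  op : ∀ k : ℕ, Level d k →L[ℂ] Level d k
  op_zero : op 0 = 1
  bounded : ∃ C : ℝ, ∀ k, ‖op k‖ ≤ C
  bounded_below : ∃ ε : ℝ, 0 < ε ∧ ∀ k, 1 ≤ k →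
    ε • (1 : Level d k →L[ℂ] Level d k) ≤ CFC.abs (op k)

namespace WeightSequence

variable {d : ℕ} (Z : WeightSequence d)

/-- Condition A(p): `‖I_p ⊗ Zₖ - Zₖ₊ₚ‖ → 0`. -/
def ConditionA (p : ℕ) : Prop :=
  Tendsto (fun k => ‖idTensor (Z.op k) p - Z.op (k + p)‖) atTop (𝓝 0)

/-- The weight operator `Z = Z₀ ⊕ Z₁ ⊕ Z₂ ⊕ ⋯`. -/
def weight : Fock d →L[ℂ] Fock d := diagonal Z.op Z.bounded

/-- The weighted shift `Wᵢ = Z Sᵢ`. -/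
def weightedShift (i : Fin d) : Fock d →L[ℂ] Fock d := Z.weight * shift i

/-- The weighted Toeplitz algebra `𝒯(ℂᵈ, Z)`, the C*-algebra generated by `W₁, …, W_d`. -/
def toeplitz : StarSubalgebra ℂ (Fock d →L[ℂ] Fock d) :=
  (StarAlgebra.adjoin ℂ (Set.range Z.weightedShift)).topologicalClosure

/-- The algebra `𝒟 = {X ∈ 𝒯 : γ_t(X) = X for all t}`. -/
def gaugeFixed : StarSubalgebra ℂ (Fock d →L[ℂ] Fock d) where
  carrier := {X | X ∈ Z.toeplitz ∧ ∀ t : ℝ, gauge d t X = X}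
  mul_mem' hX hY := ⟨mul_mem hX.1 hY.1, fun t => by rw [gauge_mul, hX.2, hY.2]⟩
  add_mem' hX hY := ⟨add_mem hX.1 hY.1, fun t => by rw [gauge_add, hX.2, hY.2]⟩
  algebraMap_mem' r := ⟨algebraMap_mem _ r, fun t => by
    rw [Algebra.algebraMap_eq_smul_one, gauge_smul, gauge_one]⟩
  star_mem' hX := ⟨star_mem hX.1, fun t => by rw [gauge_star, hX.2]⟩

/-- The space `F = {X ∈ 𝒯 : γ_t(X) = e^{it} X for all t}`. -/
def gaugeOne : Submodule ℂ (Fock d →L[ℂ] Fock d) where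
  carrier := {X | X ∈ Z.toeplitz ∧ ∀ t : ℝ, gauge d t X = Complex.exp (Complex.I * t) • X}
  add_mem' hX hY := ⟨add_mem hX.1 hY.1, fun t => by rw [gauge_add, hX.2, hY.2, smul_add]⟩
  zero_mem' := ⟨zero_mem _, fun t => by simp [gauge]⟩
  smul_mem' r X hX := ⟨Z.toeplitz.smul_mem hX.1 r, fun t => by
    rw [gauge_smul, hX.2, smul_comm]⟩

/-- The algebra `q(𝒟)` in the Calkin algebra. -/
def qD : StarSubalgebra ℂ (Calkin (Fock d)) := Z.gaugeFixed.map (calkinMap (Fock d))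

/-- The set `q(F)` in the Calkin algebra. -/
def qF : Set (Calkin (Fock d)) := calkinMap (Fock d) '' (Z.gaugeOne : Set (Fock d →L[ℂ] Fock d))

/-- The element `z = q(Z)`. -/
def z : Calkin (Fock d) := calkinMap (Fock d) Z.weight

/-- An ideal `J` of `q(𝒟)` is invariant if `q(F)* J q(F) ⊆ J`. -/
def IsInvariant (J : TwoSidedIdeal Z.qD) : Prop :=
  ∀ x ∈ Z.qF, ∀ y ∈ Z.qF, ∀ a ∈ J, ∃ b ∈ J, (b : Calkin (Fock d)) = star x * a * y

end WeightSequence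

end WeightedCuntz

end

/-! Everything takes place in the Calkin algebra. Since `∑ SᵢSᵢ* = 1 - P₀` and the vacuum projection
`P₀` is compact, the images `sᵢ = q(Sᵢ)` satisfy the Cuntz relations (`isCuntz_calkinShift`).
Condition A(1) makes `ZSᵢ - SᵢZ` compact, being a diagonal operator with norms tending to zero,
times `Sᵢ`. So `z` commutes with all `sᵢ`, and the Cuntz relations then give the same for `z*`;
hence all of `C = C*(z)` commutes with the `sᵢ` (`commute_calkinShift`).

Let `Lₙ` be the set of `y` with `s_α* y s_β ∈ C` for all words `α`, `β` of length `n`. The elements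
`s_α s_β*` are matrix units commuting with `C`, so `Lₙ` is a copy of `M_{dⁿ} ⊗ C`, and the inclusion
`Lₙ ⊆ Lₙ₊₁` is `x ↦ x ⊗ 1`. The algebra `q(𝒟)` is the closure of `⋃ Lₙ` (`coe_qD`): an element of
`𝒟` is approximated by a polynomial in the `Wᵢ` and their adjoints, averaging over the gauge action
discards its terms of nonzero degree, and terms of degree zero have image in some `Lₙ`. Conversely
`s_α c s_β*` lifts to an element of `𝒟` because the `Sᵢ` lie in `𝒯`. For positive weights this last
fact is proved by extracting `Z - P₀` from `∑ WᵢWᵢ* = (Z - P₀)²` and inverting `Z` by a Neumann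
series.

The map `u ⊗ c ↦ π(u)c` is isometric for the largest C*-seminorm (`tensorSeminorm_le`): on `M_{dⁿ} ⊗
C` it is inverted by a *-homomorphism defined on the C*-algebra `Lₙ`, which is automatically
contractive, and these subspaces are dense. Nuclearity is not needed. The range is closed, so it is
the closure of `⋃ Lₙ`.

For invariance, write `x = ∑ sᵢ(sᵢ*x)` for `x ∈ q(F)`, where `sᵢ*x ∈ q(𝒟)`; it remains to show `sᵢ*
J sⱼ ⊆ J`. The isometries `sᵢ` lie outside `q(𝒟)`, but on `Lₘ₊₁` the compression `b ↦ sᵢ* b sⱼ`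
agrees with `b ↦ ∑ₖ vₖᵢ b vₖⱼ*` for certain `vₖᵢ ∈ Lₘ₊₁` (`star_mul_mul_eq_sum`). The second map
preserves `J`; approximation and closedness of `J` finish the argument. -/

noncomputable section

namespace WeightedCuntz

/-! ### Homomorphisms out of the completion in a C*-seminorm -/

namespace CStarSeminorm

variable {A : Type*} [Ring A] [StarRing A] [Algebra ℂ A] (p : CStarSeminorm A)
variable {B : Type*} [CStarAlgebra B]

theorem toCompletion_zero : p.toCompletion 0 = 0 := by
  rw [← zero_smul ℂ (0 : A), toCompletion_smul, zero_smul]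

theorem toCompletion_neg (a : A) : p.toCompletion (-a) = -p.toCompletion a := by
  rw [← neg_one_smul ℂ a, toCompletion_smul, neg_one_smul]

theorem toCompletion_sub (a b : A) :
    p.toCompletion (a - b) = p.toCompletion a - p.toCompletion b := by
  rw [sub_eq_add_neg, toCompletion_add, toCompletion_neg, ← sub_eq_add_neg]

theorem toCompletion_one : p.toCompletion 1 = 1 :=
  UniformSpace.Completion.coe_one (α := p.Pre)

/-- The underlying function of `CStarSeminorm.lift`. -/
def liftFun (f : A →⋆ₐ[ℂ] B) : p.Completion → B :=
  UniformSpace.Completion.extension (α := p.Pre) f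

variable {p}

theorem uniformContinuous_pre {f : A →⋆ₐ[ℂ] B} (hf : ∀ a, ‖f a‖ ≤ p a) :
    UniformContinuous (fun a : p.Pre => f a) := by
  refine (LipschitzWith.of_dist_le_mul (K := 1) fun x y => ?_).uniformContinuous
  rw [dist_eq_norm, dist_eq_norm, NNReal.coe_one, one_mul]
  exact (congrArg norm (map_sub f x y)).symm.trans_le (hf (x - y))

theorem continuous_liftFun (f : A →⋆ₐ[ℂ] B) : Continuous (p.liftFun f) :=
  UniformSpace.Completion.continuous_extension

theorem liftFun_toCompletion {f : A →⋆ₐ[ℂ] B} (hf : ∀ a, ‖f a‖ ≤ p a) (a : A) :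
    p.liftFun f (p.toCompletion a) = f a :=
  UniformSpace.Completion.extension_coe (uniformContinuous_pre hf) a

/-- A contractive *-homomorphism extends to the completion. -/
def lift (f : A →⋆ₐ[ℂ] B) (hf : ∀ a, ‖f a‖ ≤ p a) : p.Completion →⋆ₐ[ℂ] B where
  toFun := p.liftFun f
  map_one' := by rw [← toCompletion_one, liftFun_toCompletion hf, map_one]
  map_zero' := by rw [← toCompletion_zero, liftFun_toCompletion hf, map_zero]
  map_mul' x y := by
    have hc := continuous_liftFun (p := p) f
    refine p.completion_induction₂
      (P := fun x y => p.liftFun f (x * y) = p.liftFun f x * p.liftFun f y) x y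
      (isClosed_eq (hc.comp continuous_mul)
        ((hc.comp continuous_fst).mul (hc.comp continuous_snd))) fun a b => ?_
    simp only [← toCompletion_mul, liftFun_toCompletion hf, map_mul]
  map_add' x y := by
    have hc := continuous_liftFun (p := p) f
    refine p.completion_induction₂
      (P := fun x y => p.liftFun f (x + y) = p.liftFun f x + p.liftFun f y) x y
      (isClosed_eq (hc.comp continuous_add)
        ((hc.comp continuous_fst).add (hc.comp continuous_snd))) fun a b => ?_
    simp only [← toCompletion_add, liftFun_toCompletion hf, map_add]
  commutes' r := by
    rw [Algebra.algebraMap_eq_smul_one, ← toCompletion_one, ← toCompletion_smul,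
      liftFun_toCompletion hf, map_smul, map_one, Algebra.algebraMap_eq_smul_one]
  map_star' x := by
    have hc := continuous_liftFun (p := p) f
    refine p.completion_induction
      (P := fun x => p.liftFun f (star x) = star (p.liftFun f x)) x
      (isClosed_eq (hc.comp p.continuous_star_completion) (continuous_star.comp hc)) fun a => ?_
    simp only [← toCompletion_star, liftFun_toCompletion hf, map_star]

theorem continuous_lift {f : A →⋆ₐ[ℂ] B} (hf : ∀ a, ‖f a‖ ≤ p a) :
    Continuous (lift f hf) := continuous_liftFun f

theorem lift_toCompletion {f : A →⋆ₐ[ℂ] B} (hf : ∀ a, ‖f a‖ ≤ p a) (a : A) :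
    lift f hf (p.toCompletion a) = f a := liftFun_toCompletion hf a

theorem norm_lift {f : A →⋆ₐ[ℂ] B} (hf : ∀ a, ‖f a‖ ≤ p a) (hf' : ∀ a, p a ≤ ‖f a‖)
    (x : p.Completion) : ‖lift f hf x‖ = ‖x‖ := by
  refine p.completion_induction (P := fun x => ‖lift f hf x‖ = ‖x‖) x
    (isClosed_eq (continuous_norm.comp (continuous_lift hf)) continuous_norm) fun a => ?_
  rw [lift_toCompletion, norm_toCompletion]
  exact le_antisymm (hf a) (hf' a)

/-- The C*-seminorm `a ↦ ‖f a‖` of a *-homomorphism `f` into a C*-algebra. -/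
def comap (f : A →⋆ₐ[ℂ] B) : CStarSeminorm A where
  toFun a := ‖f a‖
  map_zero' := by simp
  add_le' x y := by rw [map_add]; exact norm_add_le _ _
  neg' x := by rw [map_neg, norm_neg]
  smul' r x := by rw [map_smul, norm_smul]
  mul_le' x y := by rw [map_mul]; exact norm_mul_le _ _
  star_mul_self' x := by rw [map_mul, map_star, CStarRing.norm_star_mul_self]

end CStarSeminorm

/-- The seminorm `x ↦ ‖f x‖` is one of those over which the supremum is taken. -/
theorem norm_le_tensorSeminorm {A B E : Type*} [CStarAlgebra A] [CStarAlgebra B] [CStarAlgebra E]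
    (f : A ⊗[ℂ] B →⋆ₐ[ℂ] E) (x : A ⊗[ℂ] B) : ‖f x‖ ≤ tensorSeminorm A B x :=
  le_ciSup (bddAbove_cstarSeminorms x) (CStarSeminorm.comap f)

/-! ### The universal property of the direct limit -/

section DirectLimit

variable {A : ℕ → Type*} [∀ n, CStarAlgebra (A n)] (φ : ∀ n, A n →⋆ₐ[ℂ] A (n + 1))

/-- The sequence that vanishes before `n`, is `x` at `n` and is coherent after `n`. -/
def coherentSeq {n : ℕ} (x : A n) : ∀ m, A m
  | 0 => if h : n = 0 then h ▸ x else 0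
  | m + 1 => if h : n = m + 1 then h ▸ x else φ m (coherentSeq x m)

theorem coherentSeq_self {n : ℕ} (x : A n) : coherentSeq φ x n = x := by
  cases n <;> simp [coherentSeq]

theorem coherentSeq_succ {n m : ℕ} (x : A n) (h : n ≤ m) :
    coherentSeq φ x (m + 1) = φ m (coherentSeq φ x m) := by
  rw [coherentSeq, dif_neg (by omega)]

/-- A single induction for all operations of `toCoherent`: `F` stands for zero, sum, product, scalar
multiple or star. The condition `F m 0 0 = 0` handles the indices before `n`; it excludes the unit,
so `toCoherent` is a non-unital homomorphism. -/
theorem coherentSeq_op {n : ℕ} (x y w : A n) (F : ∀ m, A m → A m → A m)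
    (hF : ∀ m a b, φ m (F m a b) = F (m + 1) (φ m a) (φ m b)) (h0 : ∀ m, F m 0 0 = 0)
    (hw : w = F n x y) (m : ℕ) :
    coherentSeq φ w m = F m (coherentSeq φ x m) (coherentSeq φ y m) := by
  subst hw
  induction m with
  | zero =>
    rw [coherentSeq, coherentSeq, coherentSeq]
    by_cases h : n = 0
    · subst h; simp
    · simp [h, h0]
  | succ m ih =>
    by_cases h : n = m + 1
    · subst h; simp [coherentSeq_self]
    · simp only [coherentSeq, dif_neg h]
      rw [ih, hF]

/-- The canonical map of `A n` into the *-algebra of coherent sequences. -/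
def toCoherent (n : ℕ) : A n →⋆ₙₐ[ℂ] coherentSequences φ where
  toFun x := ⟨coherentSeq φ x, eventually_atTop.2 ⟨n, fun _ h => coherentSeq_succ φ x h⟩⟩
  map_zero' := Subtype.ext <| funext fun m =>
    coherentSeq_op φ (0 : A n) 0 0 (fun _ _ _ => 0) (by simp) (by simp) rfl m
  map_add' x y := Subtype.ext <| funext fun m =>
    coherentSeq_op φ x y _ (fun _ a b => a + b) (by simp) (by simp) rfl m
  map_mul' x y := Subtype.ext <| funext fun m =>
    coherentSeq_op φ x y _ (fun _ a b => a * b) (by simp) (by simp) rfl m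
  map_smul' r x := Subtype.ext <| funext fun m =>
    coherentSeq_op φ x x _ (fun _ a _ => r • a) (by simp) (by simp) rfl m
  map_star' x := Subtype.ext <| funext fun m =>
    coherentSeq_op φ x x _ (fun _ a _ => star a) (by simp [map_star]) (by simp) rfl m

theorem eq_of_coherent {x y : ∀ n, A n} {N : ℕ} (hx : ∀ n, N ≤ n → x (n + 1) = φ n (x n))
    (hy : ∀ n, N ≤ n → y (n + 1) = φ n (y n)) (h : x N = y N) (n : ℕ) (hn : N ≤ n) :
    x n = y n := by
  induction n, hn using Nat.le_induction with
  | base => exact h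
  | succ n hn ih => rw [hx n hn, hy n hn, ih]

theorem limitSeminorm_eq_of_tendsto {x : coherentSequences φ} {r : ℝ}
    (h : Tendsto (fun n => ‖x.1 n‖) atTop (𝓝 r)) : limitSeminorm φ x = r :=
  tendsto_nhds_unique (tendsto_norm_coherent φ x) h

/-- The canonical map of `A n` into the direct limit. -/
def toDirectLimit (n : ℕ) : A n →⋆ₙₐ[ℂ] CStarDirectLimit φ where
  toFun x := (limitSeminorm φ).toCompletion (toCoherent φ n x)
  map_zero' := by rw [map_zero, CStarSeminorm.toCompletion_zero]
  map_add' x y := by rw [map_add, CStarSeminorm.toCompletion_add]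
  map_mul' x y := by rw [map_mul, CStarSeminorm.toCompletion_mul]
  map_smul' r x := by rw [map_smul, CStarSeminorm.toCompletion_smul]; rfl
  map_star' x := by rw [map_star, CStarSeminorm.toCompletion_star]

theorem toDirectLimit_apply {n : ℕ} (x : A n) :
    toDirectLimit φ n x = (limitSeminorm φ).toCompletion (toCoherent φ n x) := rfl

/-- From `N` on, `x` is coherent, so it agrees eventually with the coherent sequence started at `x.1
n`; the limit seminorm of the difference is zero. -/
theorem toCompletion_eq_toDirectLimit (x : coherentSequences φ) :
    ∃ N, ∀ n, N ≤ n → (limitSeminorm φ).toCompletion x = toDirectLimit φ n (x.1 n) := by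
  obtain ⟨N, hN⟩ := eventually_atTop.1 (show ∀ᶠ n in atTop, x.1 (n + 1) = φ n (x.1 n) from x.2)
  refine ⟨N, fun n hn => ?_⟩
  rw [toDirectLimit_apply, ← sub_eq_zero, ← CStarSeminorm.toCompletion_sub, ← norm_eq_zero,
    CStarSeminorm.norm_toCompletion]
  refine limitSeminorm_eq_of_tendsto φ (tendsto_const_nhds.congr' ?_)
  filter_upwards [eventually_ge_atTop n] with m hm
  have h := eq_of_coherent φ (x := x.1) (y := coherentSeq φ (x.1 n)) (N := n)
    (fun k hk => hN k (hn.trans hk)) (fun k hk => coherentSeq_succ φ _ hk)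
    (coherentSeq_self φ _).symm m hm
  change 0 = ‖x.1 m - coherentSeq φ (x.1 n) m‖
  rw [h, sub_self, norm_zero]

theorem exists_toDirectLimit_near (u : CStarDirectLimit φ) {ε : ℝ} (hε : 0 < ε) :
    ∃ N, ∀ n, N ≤ n → ∃ x : A n, ‖u - toDirectLimit φ n x‖ < ε := by
  obtain ⟨x, hx⟩ := (limitSeminorm φ).denseRange_toCompletion.exists_dist_lt u hε
  obtain ⟨N, hN⟩ := toCompletion_eq_toDirectLimit φ x
  refine ⟨N, fun n hn => ⟨x.1 n, ?_⟩⟩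
  rwa [← hN n hn, ← dist_eq_norm]

variable {φ} {B : Type*} [CStarAlgebra B] {ρ : ∀ n, A n →⋆ₐ[ℂ] B}

/-- The sequence is eventually constant. -/
theorem tendsto_of_coherent (hρ : ∀ n x, ρ (n + 1) (φ n x) = ρ n x) (x : coherentSequences φ) :
    Tendsto (fun n => ρ n (x.1 n)) atTop (𝓝 (limUnder atTop fun n => ρ n (x.1 n))) := by
  apply tendsto_nhds_limUnder
  obtain ⟨N, hN⟩ := eventually_atTop.1 (show ∀ᶠ n in atTop, x.1 (n + 1) = φ n (x.1 n) from x.2)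
  refine ⟨ρ N (x.1 N), tendsto_const_nhds.congr' ?_⟩
  filter_upwards [eventually_ge_atTop N] with n hn
  induction n, hn using Nat.le_induction with
  | base => rfl
  | succ n hn ih => rw [hN n hn, hρ, ih]

/-- The *-homomorphism on coherent sequences defined by a compatible family. -/
def coherentLift (hρ : ∀ n x, ρ (n + 1) (φ n x) = ρ n x) : coherentSequences φ →⋆ₐ[ℂ] B where
  toFun x := limUnder atTop fun n => ρ n (x.1 n)
  map_one' := tendsto_nhds_unique (tendsto_of_coherent hρ 1) (by simp)
  map_zero' := tendsto_nhds_unique (tendsto_of_coherent hρ 0) (by simp)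
  map_mul' x y := tendsto_nhds_unique (tendsto_of_coherent hρ (x * y))
    (((tendsto_of_coherent hρ x).mul (tendsto_of_coherent hρ y)).congr fun n =>
      (map_mul (ρ n) _ _).symm)
  map_add' x y := tendsto_nhds_unique (tendsto_of_coherent hρ (x + y))
    (((tendsto_of_coherent hρ x).add (tendsto_of_coherent hρ y)).congr fun n =>
      (map_add (ρ n) _ _).symm)
  commutes' r := tendsto_nhds_unique (tendsto_of_coherent hρ (algebraMap ℂ _ r))
    (tendsto_const_nhds.congr fun n => (AlgHomClass.commutes (ρ n) r).symm)
  map_star' x := tendsto_nhds_unique (tendsto_of_coherent hρ (star x))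
    ((tendsto_of_coherent hρ x).star.congr fun n => (map_star (ρ n) _).symm)

theorem norm_coherentLift_le (hρ : ∀ n x, ρ (n + 1) (φ n x) = ρ n x) (x : coherentSequences φ) :
    ‖coherentLift hρ x‖ ≤ limitSeminorm φ x :=
  le_of_tendsto_of_tendsto' (tendsto_of_coherent hρ x).norm (tendsto_norm_coherent φ x)
    fun n => NonUnitalStarAlgHom.norm_apply_le (ρ n) _

/-- The *-homomorphism on the direct limit defined by a compatible family. -/
def directLimitLift (hρ : ∀ n x, ρ (n + 1) (φ n x) = ρ n x) : CStarDirectLimit φ →⋆ₐ[ℂ] B :=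
  CStarSeminorm.lift (coherentLift hρ) (norm_coherentLift_le hρ)

theorem directLimitLift_toDirectLimit (hρ : ∀ n x, ρ (n + 1) (φ n x) = ρ n x) {n : ℕ} (x : A n) :
    directLimitLift hρ (toDirectLimit φ n x) = ρ n x := by
  refine (CStarSeminorm.lift_toCompletion _ _).trans ?_
  refine tendsto_nhds_unique (tendsto_of_coherent hρ (toCoherent φ n x))
    (tendsto_const_nhds.congr' ?_)
  filter_upwards [eventually_ge_atTop n] with m hm
  change ρ n x = ρ m (coherentSeq φ x m)
  induction m, hm using Nat.le_induction with
  | base => rw [coherentSeq_self]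
  | succ m hm ih => rw [coherentSeq_succ φ x hm, hρ, ih]

theorem continuous_directLimitLift (hρ : ∀ n x, ρ (n + 1) (φ n x) = ρ n x) :
    Continuous (directLimitLift hρ) := CStarSeminorm.continuous_lift _

end DirectLimit

/-! ### Ranges of *-homomorphisms of C*-algebras are closed -/

section ClosedRange

variable {A B : Type*} [CStarAlgebra A] [CStarAlgebra B] (f : A →⋆ₐ[ℂ] B)

/-- Truncate `a` by functional calculus to the interval `[-‖f a‖, ‖f a‖]`. This commutes with `f`
and changes nothing on the spectrum of `f a`. -/
theorem exists_selfAdjoint_preimage_norm_le {a : A} (ha : IsSelfAdjoint a) :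
    ∃ a', IsSelfAdjoint a' ∧ f a' = f a ∧ ‖a'‖ ≤ ‖f a‖ := by
  let r := ‖f a‖
  have hc : Continuous fun x : ℝ => max (-r) (min x r) := by fun_prop
  refine ⟨cfc (fun x : ℝ => max (-r) (min x r)) a, cfc_predicate _ a, ?_, ?_⟩
  · have hfa : IsSelfAdjoint (f a) := ha.map f
    rw [StarAlgHom.map_cfc (R := ℝ) (S := ℂ) f _ a hc.continuousOn
      (AddMonoidHomClass.continuous_of_bound f 1
        fun x => by simpa using NonUnitalStarAlgHom.norm_apply_le f x)]
    conv_rhs => rw [← cfc_id ℝ (f a)]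
    refine cfc_congr fun x hx => ?_
    have h : |x| ≤ r := IsometricContinuousFunctionalCalculus.norm_spectrum_le (f a) hx hfa
    rw [abs_le] at h
    rw [id, min_eq_left h.2, max_eq_right h.1]
  · refine norm_cfc_le (norm_nonneg _) fun x _ => ?_
    rw [Real.norm_eq_abs, abs_le]
    exact ⟨le_max_left _ _, max_le (by linarith [norm_nonneg (f a)]) (min_le_right _ _)⟩

/-- Real and imaginary parts are lifted separately, whence the constant 2; any constant would do for
the closed range. -/
theorem exists_preimage_norm_le (a : A) : ∃ a', f a' = f a ∧ ‖a'‖ ≤ 2 * ‖f a‖ := by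
  obtain ⟨x, -, hx, hxn⟩ := exists_selfAdjoint_preimage_norm_le f (realPart a).2
  obtain ⟨y, -, hy, hyn⟩ := exists_selfAdjoint_preimage_norm_le f (imaginaryPart a).2
  refine ⟨x + Complex.I • y, ?_, ?_⟩
  · conv_rhs => rw [← realPart_add_I_smul_imaginaryPart a]
    simp only [map_add, map_smul, hx, hy]
  · have h1 : ‖f (realPart a : A)‖ ≤ ‖f a‖ := by
      have : f (realPart a : A) = (realPart (f a) : B) := by
        simp [realPart_apply_coe, ← Complex.coe_smul, map_star]
      rw [this]
      exact realPart.norm_le (f a)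
    have h2 : ‖f (imaginaryPart a : A)‖ ≤ ‖f a‖ := by
      have : f (imaginaryPart a : A) = (imaginaryPart (f a) : B) := by
        simp [imaginaryPart_apply_coe, ← Complex.coe_smul, map_star]
      rw [this]
      exact imaginaryPart.norm_le (f a)
    refine (norm_add_le _ _).trans ?_
    rw [norm_smul, Complex.norm_I, one_mul]
    linarith

/-- Preimages with controlled norm let a convergent sequence in the range be lifted term by term to
a convergent series in the complete algebra `A`. -/
theorem isClosed_range_starAlgHom : IsClosed (Set.range f) := by
  let F : NormedAddGroupHom A B := (f : A →+ B).mkNormedAddGroupHom 1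
    fun x => by simpa using NonUnitalStarAlgHom.norm_apply_le f x
  have h := controlled_closure_of_complete (f := F) (K := F.range) (C := 2) (ε := 1)
    (by norm_num) (by norm_num) (by
      rintro _ ⟨a, rfl⟩
      obtain ⟨a', h, hn⟩ := exists_preimage_norm_le f a
      exact ⟨a', h, hn⟩)
  refine isClosed_of_closure_subset fun b hb => ?_
  obtain ⟨a, ha, -⟩ := h b hb
  exact ⟨a, ha⟩

end ClosedRange

/-! ### Cuntz isometries and matrix units over a commuting subalgebra -/

section Cuntz

variable {Q : Type*} [CStarAlgebra Q] {d : ℕ}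

/-- The Cuntz relations. -/
structure IsCuntz (s : Fin d → Q) : Prop where
  orthonormal : ∀ i j, star (s i) * s j = if i = j then 1 else 0
  sum_mul_star : ∑ i, s i * star (s i) = 1

/-- The product `s_{α₁} ⋯ s_{αₙ}`. -/
def word (s : Fin d → Q) : (n : ℕ) → (Fin n → Fin d) → Q
  | 0, _ => 1
  | n + 1, α => word s n (Fin.init α) * s (α (Fin.last n))

variable {s : Fin d → Q}

theorem word_snoc {n : ℕ} (α : Fin n → Fin d) (i : Fin d) :
    word s (n + 1) (Fin.snoc (α := fun _ => Fin d) α i) = word s n α * s i := by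
  rw [word, Fin.init_snoc, Fin.snoc_last]

/-- The recursive definition splits off the last letter, as the embeddings `x ↦ x ⊗ 1` require.
Compressions `sᵢ* y sⱼ` act on the first letter. -/
theorem word_cons {n : ℕ} (i : Fin d) (α : Fin n → Fin d) :
    word s (n + 1) (Fin.cons (α := fun _ => Fin d) i α) = s i * word s n α := by
  induction n with
  | zero =>
    rw [word, word, word, one_mul, mul_one]
    rfl
  | succ n ih =>
    have h : (Fin.init (Fin.cons (α := fun _ => Fin d) i α) : Fin (n + 1) → Fin d) =
        Fin.cons (α := fun _ => Fin d) i (Fin.init α) := by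
      ext k
      refine Fin.cases ?_ (fun k => ?_) k <;> rfl
    have hl : (Fin.cons (α := fun _ => Fin d) i α : Fin (n + 2) → Fin d) (Fin.last (n + 1)) =
        α (Fin.last n) := rfl
    conv_lhs => rw [word]
    rw [h, ih, hl, mul_assoc]
    conv_rhs => rw [word]

theorem sum_words_succ {M : Type*} [AddCommMonoid M] {n : ℕ} (f : (Fin (n + 1) → Fin d) → M) :
    ∑ α, f α = ∑ α : Fin n → Fin d, ∑ i, f (Fin.snoc (α := fun _ => Fin d) α i) := by
  rw [← (Fin.snocEquiv fun _ => Fin d).sum_comp, Fintype.sum_prod_type, Finset.sum_comm]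
  rfl

namespace IsCuntz

variable (hs : IsCuntz s)
include hs

theorem star_word_mul_word {n : ℕ} (α β : Fin n → Fin d) :
    star (word s n α) * word s n β = if α = β then 1 else 0 := by
  induction n with
  | zero => simp [word, Subsingleton.elim α β]
  | succ n ih =>
    have h : α = β ↔ Fin.init α = Fin.init β ∧ α (Fin.last n) = β (Fin.last n) := by
      conv_lhs => rw [← Fin.snoc_init_self α, ← Fin.snoc_init_self β]
      exact Fin.snoc_inj
    rw [word, word, star_mul, mul_assoc, ← mul_assoc (star (word s n _)), ih]
    simp only [h]
    by_cases h1 : Fin.init α = Fin.init β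
    · simp [h1, hs.orthonormal]
    · simp [h1]

theorem sum_word_mul_star (n : ℕ) : ∑ α, word s n α * star (word s n α) = 1 := by
  induction n with
  | zero => simp [word]
  | succ n ih =>
    rw [sum_words_succ]
    simp only [word_snoc, star_mul, mul_assoc]
    simp only [← mul_assoc (s _), ← Finset.mul_sum, ← Finset.sum_mul, hs.sum_mul_star, one_mul, ih]

end IsCuntz

variable (s) (C : StarSubalgebra ℂ Q)

/-- The space of all `y` with `s_α* y s_β ∈ C` for all words `α` and `β` of lengths `p`
and `q`. -/
def cornerSpace (p q : ℕ) : Submodule ℂ Q where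
  carrier := {y | ∀ (α : Fin p → Fin d) (β : Fin q → Fin d),
    star (word s p α) * y * word s q β ∈ C}
  add_mem' hx hy α β := by
    rw [mul_add, add_mul]; exact add_mem (hx α β) (hy α β)
  zero_mem' α β := by simp
  smul_mem' r x hx α β := by
    rw [mul_smul_comm, smul_mul_assoc]; exact C.smul_mem (hx α β) r

variable {s C}

theorem star_mem_cornerSpace {p q : ℕ} {y : Q} (hy : y ∈ cornerSpace s C p q) :
    star y ∈ cornerSpace s C q p := fun α β => by
  have := star_mem (hy β α)
  rwa [star_mul, star_mul, star_star, ← mul_assoc] at this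

theorem commute_star {c : Q} (hC : ∀ c ∈ C, ∀ i, Commute c (s i)) (hc : c ∈ C) (i : Fin d) :
    Commute c (star (s i)) := by
  simpa using (hC _ (star_mem hc) i).star_star

theorem commute_word {c : Q} (hC : ∀ c ∈ C, ∀ i, Commute c (s i)) (hc : c ∈ C) (n : ℕ)
    (α : Fin n → Fin d) : Commute c (word s n α) := by
  induction n with
  | zero => exact Commute.one_right c
  | succ n ih => exact (ih _).mul_right (hC c hc _)

theorem commute_star_word {c : Q} (hC : ∀ c ∈ C, ∀ i, Commute c (s i)) (hc : c ∈ C) (n : ℕ)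
    (α : Fin n → Fin d) : Commute c (star (word s n α)) := by
  simpa using (commute_word hC (star_mem hc) n α).star_star

namespace IsCuntz

variable (hs : IsCuntz s) (hC : ∀ c ∈ C, ∀ i, Commute c (s i))
include hs

/-- Insert `∑ s_α s_α* = 1` on both sides. Thus an element of `cornerSpace s C p q` is a sum of
terms `s_α c s_β*` with `c ∈ C`, while the description by corners makes products and closedness
easy. -/
theorem eq_sum_corner (p q : ℕ) (y : Q) :
    y = ∑ α, ∑ β, word s p α * (star (word s p α) * y * word s q β) * star (word s q β) := by
  have h : y = (∑ α, word s p α * star (word s p α)) * y *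
      ∑ β, word s q β * star (word s q β) := by
    rw [hs.sum_word_mul_star, hs.sum_word_mul_star, one_mul, mul_one]
  conv_lhs => rw [h, Finset.sum_mul, Finset.sum_mul]
  simp only [Finset.mul_sum, mul_assoc]

theorem star_word_mul_mul_word {p q r : ℕ} (x y : Q) (α : Fin p → Fin d) (β : Fin r → Fin d) :
    star (word s p α) * (x * y) * word s r β = ∑ γ, (star (word s p α) * x * word s q γ) *
      (star (word s q γ) * y * word s r β) := by
  have h : x * y = ∑ γ, x * (word s q γ * star (word s q γ)) * y := by
    rw [← Finset.sum_mul, ← Finset.mul_sum, hs.sum_word_mul_star, mul_one]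
  rw [h, Finset.mul_sum, Finset.sum_mul]
  simp only [mul_assoc]

theorem mul_mem_cornerSpace {p q r : ℕ} {x y : Q} (hx : x ∈ cornerSpace s C p q)
    (hy : y ∈ cornerSpace s C q r) : x * y ∈ cornerSpace s C p r := fun α β => by
  rw [hs.star_word_mul_mul_word (q := q)]
  exact sum_mem fun γ _ => mul_mem (hx α γ) (hy γ β)

include hC

/-- The new corner is `sᵢ* c sⱼ = c sᵢ* sⱼ`, which is `c` or `0`. -/
theorem cornerSpace_le_succ (p q : ℕ) :
    cornerSpace s C p q ≤ cornerSpace s C (p + 1) (q + 1) := fun y hy α β => by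
  have h := hy (Fin.init α) (Fin.init β)
  rw [word, word, star_mul, show star (s (α (Fin.last p))) * star (word s p (Fin.init α)) * y *
    (word s q (Fin.init β) * s (β (Fin.last q))) = star (s (α (Fin.last p))) *
    (star (word s p (Fin.init α)) * y * word s q (Fin.init β)) * s (β (Fin.last q)) by
      simp only [mul_assoc], ← (commute_star hC h _).eq, mul_assoc, hs.orthonormal]
  split_ifs
  · rwa [mul_one]
  · simp

theorem cornerSpace_le_add (p q k : ℕ) :
    cornerSpace s C p q ≤ cornerSpace s C (p + k) (q + k) := by
  induction k with
  | zero => exact le_rfl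
  | succ k ih => exact ih.trans (hs.cornerSpace_le_succ hC _ _)

/-- Lengthen the words on both sides of `x` by `p'` and of `y` by `q`, so that the inner words both
have length `q + p'`. -/
theorem mul_mem_cornerSpace' {p q p' q' : ℕ} {x y : Q} (hx : x ∈ cornerSpace s C p q)
    (hy : y ∈ cornerSpace s C p' q') : x * y ∈ cornerSpace s C (p + p') (q' + q) := by
  refine hs.mul_mem_cornerSpace (q := q + p') (hs.cornerSpace_le_add hC p q p' hx) ?_
  rw [add_comm q p']
  exact hs.cornerSpace_le_add hC p' q' q hy

omit hs hC

theorem mem_cornerSpace_zero {c : Q} (hc : c ∈ C) : c ∈ cornerSpace s C 0 0 := fun α β => by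
  simpa [word] using hc

include hs hC in
theorem generator_mem_cornerSpace {c : Q} (i : Fin d) (hc : c ∈ C) : c * s i ∈ cornerSpace s C 1 0 :=
  fun α β => by
    rw [(hC c hc i).eq]
    simp only [word, one_mul, mul_one, ← mul_assoc, hs.orthonormal]
    split_ifs <;> simp [hc]

include hs

/-- The algebra spanned by the elements `s_α c s_β*` with `c ∈ C` and `α`, `β` of length `n`. -/
def level (C : StarSubalgebra ℂ Q) (n : ℕ) : StarSubalgebra ℂ Q where
  carrier := cornerSpace s C n n
  mul_mem' hx hy := hs.mul_mem_cornerSpace hx hy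
  add_mem' hx hy := add_mem hx hy
  algebraMap_mem' r := by
    rw [Algebra.algebraMap_eq_smul_one]
    refine (cornerSpace s C n n).smul_mem r fun α β => ?_
    rw [mul_one, hs.star_word_mul_word]
    split_ifs <;> simp
  star_mem' hx := star_mem_cornerSpace hx

include hC in
theorem level_mono : Monotone (hs.level C) :=
  monotone_nat_of_le_succ fun n => hs.cornerSpace_le_succ hC n n

/-- Closedness makes the level a C*-algebra, so that *-homomorphisms out of it into C*-algebras are
contractive. -/
instance [hcl : IsClosed (C : Set Q)] (n : ℕ) : IsClosed (hs.level C n : Set Q) := by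
  have : (hs.level C n : Set Q) = ⋂ α, ⋂ β,
      (fun y => star (word s n α) * y * word s n β) ⁻¹' (C : Set Q) := by
    ext y; simp only [Set.mem_iInter]; exact Iff.rfl
  rw [this]
  exact isClosed_iInter fun α => isClosed_iInter fun β => hcl.preimage (by fun_prop)

theorem word_mul_mul_star_word_mem_level {n : ℕ} (α β : Fin n → Fin d)
    {c : Q} (hc : c ∈ C) : word s n α * c * star (word s n β) ∈ hs.level C n := fun γ δ => by
  rw [show star (word s n γ) * (word s n α * c * star (word s n β)) * word s n δ =
    (star (word s n γ) * word s n α) * c * (star (word s n β) * word s n δ) by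
      simp only [mul_assoc], hs.star_word_mul_word, hs.star_word_mul_word]
  split_ifs <;> simp [hc]

/-- The *-homomorphism of `M_{dⁿ}` given by the matrix units `s_α s_β*`. -/
def matrixRep (n : ℕ) : MatrixLevel d n →⋆ₐ[ℂ] Q where
  toFun x := ∑ α, ∑ β, x α β • (word s n α * star (word s n β))
  map_one' := by
    simp [CStarMatrix.one_apply, ite_smul, hs.sum_word_mul_star]
  map_mul' x y := by
    have h : ∀ α β γ δ, (x α β • (word s n α * star (word s n β))) *
        (y γ δ • (word s n γ * star (word s n δ))) =
        if β = γ then (x α β * y γ δ) • (word s n α * star (word s n δ)) else 0 := by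
      intro α β γ δ
      rw [smul_mul_smul_comm, mul_assoc, ← mul_assoc (star _), hs.star_word_mul_word]
      split_ifs <;> simp
    simp only [Finset.sum_mul, Finset.mul_sum, h, CStarMatrix.mul_apply, Finset.sum_smul]
    simp only [Finset.sum_ite_eq', Finset.mem_univ, if_true]
    exact Finset.sum_comm.trans
      ((Finset.sum_congr rfl fun β _ => Finset.sum_comm).trans Finset.sum_comm)
  map_zero' := by simp
  map_add' x y := by simp [add_smul, Finset.sum_add_distrib]
  commutes' r := by
    simp only [Algebra.algebraMap_eq_smul_one, CStarMatrix.smul_apply, CStarMatrix.one_apply]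
    simp [ite_smul, ← Finset.smul_sum, hs.sum_word_mul_star]
  map_star' x := by
    rw [star_sum, Finset.sum_comm]
    simp [star_sum, CStarMatrix.star_apply]

theorem matrixRep_apply {n : ℕ} (x : MatrixLevel d n) :
    hs.matrixRep n x = ∑ α, ∑ β, x α β • (word s n α * star (word s n β)) := rfl

/-- The sum `∑ᵢ s_α sᵢ sᵢ* s_β*` collapses to `s_α s_β*`. -/
theorem matrixRep_matrixEmbedding (n : ℕ) (x : MatrixLevel d n) :
    hs.matrixRep (n + 1) (matrixEmbedding d n x) = hs.matrixRep n x := by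
  rw [matrixRep_apply, matrixRep_apply, sum_words_succ]
  refine Finset.sum_congr rfl fun α _ => ?_
  simp only [sum_words_succ]
  rw [Finset.sum_comm]
  refine Finset.sum_congr rfl fun β _ => ?_
  change ∑ i, ∑ j, matrixTensorOne x _ _ • _ = _
  simp only [matrixTensorOne_apply, Fin.snoc_last, Fin.init_snoc, word_snoc, ite_smul, zero_smul,
    Finset.sum_ite_eq, Finset.mem_univ, if_true, ← Finset.smul_sum, star_mul]
  congr 1
  simp only [mul_assoc]
  simp only [← mul_assoc (s _), ← Finset.mul_sum, ← Finset.sum_mul, hs.sum_mul_star, one_mul]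

theorem star_word_mul_matrixRep_mul_word {n : ℕ} (x : MatrixLevel d n) (α β : Fin n → Fin d) :
    star (word s n α) * hs.matrixRep n x * word s n β = x α β • (1 : Q) := by
  have h : ∀ γ δ, star (word s n α) * (x γ δ • (word s n γ * star (word s n δ))) * word s n β =
      if α = γ then if δ = β then x γ δ • (1 : Q) else 0 else 0 := fun γ δ => by
    rw [mul_smul_comm, smul_mul_assoc, ← mul_assoc, mul_assoc, hs.star_word_mul_word,
      hs.star_word_mul_word]
    split_ifs <;> simp
  simp only [matrixRep_apply, Finset.mul_sum, Finset.sum_mul, h]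
  simp

/-- The *-homomorphism of the UHF algebra given by the matrix units `s_α s_β*`. -/
def uhfRep : UHF d →⋆ₐ[ℂ] Q := directLimitLift hs.matrixRep_matrixEmbedding

theorem uhfRep_toDirectLimit {n : ℕ} (x : MatrixLevel d n) :
    hs.uhfRep (toDirectLimit (matrixEmbedding d) n x) = hs.matrixRep n x :=
  directLimitLift_toDirectLimit _ x

end IsCuntz

end Cuntz

/-! ### The C*-tensor product of the UHF algebra with a commuting subalgebra -/

theorem directLimit_induction {A : ℕ → Type*} [∀ n, CStarAlgebra (A n)]
    (φ : ∀ n, A n →⋆ₐ[ℂ] A (n + 1)) {P : CStarDirectLimit φ → Prop} (u : CStarDirectLimit φ)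
    (hc : IsClosed {u | P u}) (h : ∀ n x, P (toDirectLimit φ n x)) : P u := by
  refine (limitSeminorm φ).completion_induction u hc fun a => ?_
  obtain ⟨N, hN⟩ := toCompletion_eq_toDirectLimit φ a
  rw [hN N le_rfl]
  exact h _ _

/-- The matrix units of `M_{dⁿ}`. -/
def matrixUnit {d n : ℕ} (α β : Fin n → Fin d) : MatrixLevel d n :=
  CStarMatrix.ofMatrix (Matrix.single α β 1)

theorem matrixUnit_mul {d n : ℕ} (α β γ δ : Fin n → Fin d) :
    matrixUnit α β * matrixUnit γ δ = if β = γ then matrixUnit α δ else 0 := by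
  change CStarMatrix.ofMatrix (Matrix.single α β (1 : ℂ) * Matrix.single γ δ 1) = _
  split_ifs with h
  · subst h
    rw [Matrix.single_mul_single_same, mul_one, matrixUnit]
  · rw [Matrix.single_mul_single_of_ne _ _ _ _ h]
    rfl

theorem star_matrixUnit {d n : ℕ} (α β : Fin n → Fin d) :
    star (matrixUnit α β) = matrixUnit β α := by
  change CStarMatrix.ofMatrix (star (Matrix.single α β (1 : ℂ))) = _
  rw [Matrix.star_eq_conjTranspose, Matrix.conjTranspose_single, star_one, matrixUnit]

theorem matrixUnit_apply {d n : ℕ} (α β γ δ : Fin n → Fin d) :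
    (matrixUnit α β : MatrixLevel d n) γ δ = if α = γ then if β = δ then 1 else 0 else 0 := by
  change Matrix.single α β (1 : ℂ) γ δ = _
  rw [Matrix.single_apply]
  split_ifs <;> simp_all

theorem eq_sum_matrixUnit {d n : ℕ} (x : MatrixLevel d n) :
    x = ∑ α, ∑ β, x α β • matrixUnit α β := by
  ext γ δ
  have hs : ∀ (t : Finset (Fin n → Fin d)) (f : (Fin n → Fin d) → MatrixLevel d n),
      (∑ i ∈ t, f i) γ δ = ∑ i ∈ t, f i γ δ := fun t f => by
    induction t using Finset.cons_induction with
    | empty => rfl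
    | cons i t hi ih => rw [Finset.sum_cons, Finset.sum_cons, CStarMatrix.add_apply, ih]
  simp only [hs, CStarMatrix.smul_apply, matrixUnit_apply]
  simp

section TensorRep

variable {Q : Type*} [CStarAlgebra Q] {d : ℕ} {s : Fin d → Q} {C : StarSubalgebra ℂ Q}

namespace IsCuntz

variable (hs : IsCuntz s)

theorem matrixRep_commute (hC : ∀ c ∈ C, ∀ i, Commute c (s i)) {c : Q} (hc : c ∈ C) {n : ℕ}
    (x : MatrixLevel d n) : Commute (hs.matrixRep n x) c := by
  rw [matrixRep_apply]
  exact Commute.sum_left _ _ _ fun α _ => Commute.sum_left _ _ _ fun β _ =>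
    (((commute_word hC hc n α).mul_right (commute_star_word hC hc n β)).symm).smul_left _

theorem uhfRep_commute (hC : ∀ c ∈ C, ∀ i, Commute c (s i)) {c : Q} (hc : c ∈ C) (u : UHF d) :
    Commute (hs.uhfRep u) c := by
  have hcont : Continuous hs.uhfRep := continuous_directLimitLift _
  refine directLimit_induction (matrixEmbedding d) u
    (isClosed_eq (hcont.mul continuous_const) (continuous_const.mul hcont)) fun n x => ?_
  change hs.uhfRep _ * c = c * hs.uhfRep _
  rw [uhfRep_toDirectLimit]
  exact hs.matrixRep_commute hC hc x

/-- The homomorphism `u ⊗ c ↦ uhfRep u * c`. -/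
def tensorRepAlg (hC : ∀ c ∈ C, ∀ i, Commute c (s i)) : UHF d ⊗[ℂ] C →ₐ[ℂ] Q :=
  Algebra.TensorProduct.lift (hs.uhfRep : UHF d →ₐ[ℂ] Q) (C.subtype : C →ₐ[ℂ] Q)
    fun u c => hs.uhfRep_commute hC c.2 u

theorem tensorRepAlg_tmul (hC : ∀ c ∈ C, ∀ i, Commute c (s i)) (u : UHF d) (c : C) :
    hs.tensorRepAlg hC (u ⊗ₜ c) = hs.uhfRep u * c :=
  Algebra.TensorProduct.lift_tmul (hs.uhfRep : UHF d →ₐ[ℂ] Q) (C.subtype : C →ₐ[ℂ] Q)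
    (fun u c => hs.uhfRep_commute hC c.2 u) u c

/-- The *-homomorphism `u ⊗ c ↦ uhfRep u * c`. -/
def tensorRep (hC : ∀ c ∈ C, ∀ i, Commute c (s i)) : UHF d ⊗[ℂ] C →⋆ₐ[ℂ] Q where
  __ := hs.tensorRepAlg hC
  map_star' x := by
    change hs.tensorRepAlg hC (star x) = star (hs.tensorRepAlg hC x)
    induction x with
    | zero => simp
    | add x y hx hy => rw [star_add, map_add, map_add, star_add, hx, hy]
    | tmul u c =>
      rw [TensorProduct.star_tmul, tensorRepAlg_tmul, tensorRepAlg_tmul, star_mul, map_star,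
        ← map_star]
      exact hs.uhfRep_commute hC (star_mem c.2) (star u)

theorem tensorRep_tmul (hC : ∀ c ∈ C, ∀ i, Commute c (s i)) (u : UHF d) (c : C) :
    hs.tensorRep hC (u ⊗ₜ c) = hs.uhfRep u * c := hs.tensorRepAlg_tmul hC u c

/-- The map `y ↦ s_α* y s_β` from `hs.level C n` to `C`. -/
def corner {n : ℕ} (α β : Fin n → Fin d) : hs.level C n →ₗ[ℂ] C where
  toFun y := ⟨star (word s n α) * y * word s n β, y.2 α β⟩
  map_add' x y := Subtype.ext <| by
    change star (word s n α) * (x + y) * _ = star (word s n α) * x * _ + star (word s n α) * y * _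
    rw [mul_add, add_mul]
  map_smul' r x := Subtype.ext <| by
    change star (word s n α) * (r • x) * _ = r • (star (word s n α) * x * _)
    rw [mul_smul_comm, smul_mul_assoc]

theorem corner_mul {n : ℕ} (α β : Fin n → Fin d) (x y : hs.level C n) :
    hs.corner α β (x * y) = ∑ γ, hs.corner α γ x * hs.corner γ β y := Subtype.ext <| by
  rw [AddSubmonoidClass.coe_finsetSum]
  exact hs.star_word_mul_mul_word (q := n) _ _ _ _

theorem corner_star {n : ℕ} (α β : Fin n → Fin d) (y : hs.level C n) :
    hs.corner α β (star y) = star (hs.corner β α y) := Subtype.ext <| by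
  change star (word s n α) * star (y : Q) * word s n β = star (star (word s n β) * y * word s n α)
  simp [mul_assoc]

/-- The *-homomorphism `y ↦ ∑ e_{αβ} ⊗ s_α* y s_β` inverting `tensorRep` on `M_{dⁿ} ⊗ C`. -/
def levelToTensor (n : ℕ) : hs.level C n →⋆ₙₐ[ℂ] UHF d ⊗[ℂ] C where
  toFun y := ∑ α, ∑ β,
    toDirectLimit (matrixEmbedding d) n (matrixUnit α β) ⊗ₜ hs.corner α β y
  map_smul' r y := by
    simp [Finset.smul_sum, TensorProduct.tmul_smul]
  map_zero' := by simp
  map_add' x y := by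
    simp [Finset.sum_add_distrib, TensorProduct.tmul_add]
  map_mul' x y := by
    have h : ∀ α β γ δ : Fin n → Fin d, (toDirectLimit (matrixEmbedding d) n (matrixUnit α β) ⊗ₜ
        hs.corner α β x) * (toDirectLimit (matrixEmbedding d) n (matrixUnit γ δ) ⊗ₜ
        hs.corner γ δ y) = if β = γ then (toDirectLimit (matrixEmbedding d) n
          (matrixUnit α δ) ⊗ₜ[ℂ] (hs.corner α β x * hs.corner γ δ y)) else 0 := by
      intro α β γ δ
      rw [Algebra.TensorProduct.tmul_mul_tmul, ← map_mul, matrixUnit_mul]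
      split_ifs
      · rfl
      · rw [map_zero, TensorProduct.zero_tmul]
    simp only [Finset.sum_mul, Finset.mul_sum, h, corner_mul, TensorProduct.tmul_sum]
    simp only [Finset.sum_ite_eq', Finset.mem_univ, if_true]
    exact Finset.sum_comm.trans
      ((Finset.sum_congr rfl fun β _ => Finset.sum_comm).trans Finset.sum_comm)
  map_star' y := by
    rw [star_sum, Finset.sum_comm]
    simp only [star_sum, TensorProduct.star_tmul, ← map_star, star_matrixUnit, corner_star]

theorem levelToTensor_apply {n : ℕ} (y : hs.level C n) : hs.levelToTensor n y = ∑ α, ∑ β,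
    toDirectLimit (matrixEmbedding d) n (matrixUnit α β) ⊗ₜ hs.corner α β y := rfl

variable (C) in
/-- The image of `M_{dⁿ} ⊗ C` in `UHF d ⊗ C`. -/
def tensorLevel (d n : ℕ) : Submodule ℂ (UHF d ⊗[ℂ] C) :=
  Submodule.span ℂ (Set.range fun x : MatrixLevel d n × C =>
    toDirectLimit (matrixEmbedding d) n x.1 ⊗ₜ x.2)

/-- On `M_{dⁿ} ⊗ C` the map `levelToTensor` is a left inverse of `tensorRep`: the corners of the
image of `a ⊗ c` are `a_{αβ} c`, and `a = ∑ a_{αβ} e_{αβ}`. -/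
theorem exists_levelToTensor_eq (hC : ∀ c ∈ C, ∀ i, Commute c (s i)) {n : ℕ} {x : UHF d ⊗[ℂ] C}
    (hx : x ∈ tensorLevel C d n) :
    ∃ y : hs.level C n, (y : Q) = hs.tensorRep hC x ∧ hs.levelToTensor n y = x := by
  induction hx using Submodule.span_induction with
  | mem x hx =>
    obtain ⟨⟨a, c⟩, rfl⟩ := hx
    have hcor : ∀ α β, star (word s n α) * hs.tensorRep hC
        (toDirectLimit (matrixEmbedding d) n a ⊗ₜ c) * word s n β = a α β • (c : Q) := by
      intro α β
      rw [tensorRep_tmul, uhfRep_toDirectLimit, mul_assoc, mul_assoc,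
        (commute_word hC c.2 n β).eq, ← mul_assoc (hs.matrixRep n a), ← mul_assoc,
        ← mul_assoc, star_word_mul_matrixRep_mul_word, smul_one_mul]
    refine ⟨⟨_, fun α β => ?_⟩, rfl, ?_⟩
    · rw [hcor]; exact C.smul_mem c.2 _
    · rw [levelToTensor_apply]
      conv_rhs => rw [eq_sum_matrixUnit a]
      simp only [map_sum, map_smul, TensorProduct.sum_tmul]
      refine Finset.sum_congr rfl fun α _ => Finset.sum_congr rfl fun β _ => ?_
      rw [← TensorProduct.smul_tmul', ← TensorProduct.tmul_smul]
      congr 1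
      exact Subtype.ext (hcor α β)
  | zero => exact ⟨0, by simp, by simp⟩
  | add x y _ _ hx hy =>
    obtain ⟨a, ha, rfl⟩ := hx
    obtain ⟨b, hb, rfl⟩ := hy
    exact ⟨a + b, by rw [map_add, ← ha, ← hb]; rfl, map_add _ _ _⟩
  | smul r x _ hx =>
    obtain ⟨a, ha, rfl⟩ := hx
    exact ⟨r • a, by rw [map_smul, ← ha]; rfl, map_smul _ _ _⟩

theorem matrixRep_matrixUnit {n : ℕ} (α β : Fin n → Fin d) :
    hs.matrixRep n (matrixUnit α β) = word s n α * star (word s n β) := by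
  simp only [matrixRep_apply, matrixUnit_apply, ite_smul, one_smul, zero_smul]
  simp

variable [IsClosed (C : Set Q)]

/-- `CStarSeminorm.toCompletion` as a *-homomorphism. -/
def _root_.WeightedCuntz.CStarSeminorm.toCompletionHom {A : Type*} [Ring A] [StarRing A]
    [Algebra ℂ A] (p : CStarSeminorm A) : A →⋆ₙₐ[ℂ] p.Completion where
  toFun := p.toCompletion
  map_smul' := p.toCompletion_smul
  map_zero' := p.toCompletion_zero
  map_add' := p.toCompletion_add
  map_mul' := p.toCompletion_mul
  map_star' := p.toCompletion_star

/-- The left inverse, followed by the map into the completion, is a *-homomorphism between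
C*-algebras and hence contractive. -/
theorem tensorSeminorm_le_of_mem (hC : ∀ c ∈ C, ∀ i, Commute c (s i)) {n : ℕ}
    {x : UHF d ⊗[ℂ] C} (hx : x ∈ tensorLevel C d n) :
    tensorSeminorm (UHF d) C x ≤ ‖hs.tensorRep hC x‖ := by
  obtain ⟨y, hy, rfl⟩ := hs.exists_levelToTensor_eq hC hx
  rw [← hy, ← CStarSeminorm.norm_toCompletion]
  exact NonUnitalStarAlgHom.norm_apply_le
    ((tensorSeminorm (UHF d) C).toCompletionHom.comp (hs.levelToTensor (C := C) n)) y

omit hs in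
theorem exists_tensorLevel_near (x : UHF d ⊗[ℂ] C) {ε : ℝ} (hε : 0 < ε) :
    ∃ N, ∀ n, N ≤ n → ∃ y ∈ tensorLevel C d n, tensorSeminorm (UHF d) C (x - y) < ε := by
  induction x generalizing ε with
  | zero => exact ⟨0, fun n _ => ⟨0, zero_mem _, by
      rw [sub_zero]; exact (map_zero (tensorSeminorm (UHF d) C).toSeminorm).trans_lt hε⟩⟩
  | add x y hx hy =>
    obtain ⟨N, hN⟩ := hx (half_pos hε)
    obtain ⟨M, hM⟩ := hy (half_pos hε)
    refine ⟨max N M, fun n hn => ?_⟩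
    obtain ⟨a, ha, h1⟩ := hN n (le_of_max_le_left hn)
    obtain ⟨b, hb, h2⟩ := hM n (le_of_max_le_right hn)
    refine ⟨a + b, add_mem ha hb, ?_⟩
    have := map_add_le_add (tensorSeminorm (UHF d) C).toSeminorm (x - a) (y - b)
    rw [add_sub_add_comm]
    linarith
  | tmul u c =>
    -- The seminorm of `(u - a) ⊗ c` is at most `‖u - a‖ ‖c‖`; the added 1 keeps the quotient
    -- meaningful for `c = 0`.
    obtain ⟨N, hN⟩ := exists_toDirectLimit_near (matrixEmbedding d) u
      (ε := ε / (‖c‖ + 1)) (by positivity)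
    refine ⟨N, fun n hn => ?_⟩
    obtain ⟨a, ha⟩ := hN n hn
    refine ⟨_, Submodule.subset_span ⟨(a, c), rfl⟩, ?_⟩
    rw [← TensorProduct.sub_tmul]
    refine ((tensorSeminorm (UHF d) C).tmul_le _ _).trans_lt ?_
    rw [lt_div_iff₀ (by positivity)] at ha
    refine lt_of_le_of_lt ?_ ha
    gcongr
    linarith

/-- Both sides are continuous for the largest C*-seminorm, so the estimate on the dense subspaces
`tensorLevel C d n` extends. Together with `norm_le_tensorSeminorm` it makes `tensorRep` isometric.
-/
theorem tensorSeminorm_le (hC : ∀ c ∈ C, ∀ i, Commute c (s i)) (x : UHF d ⊗[ℂ] C) :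
    tensorSeminorm (UHF d) C x ≤ ‖hs.tensorRep hC x‖ := by
  refine le_of_forall_pos_le_add fun ε hε => ?_
  obtain ⟨N, hN⟩ := exists_tensorLevel_near x (half_pos hε)
  obtain ⟨y, hy, hxy⟩ := hN N le_rfl
  have h1 := hs.tensorSeminorm_le_of_mem hC hy
  have h2 := norm_le_tensorSeminorm (hs.tensorRep hC) (x - y)
  have h3 := map_add_le_add (tensorSeminorm (UHF d) C).toSeminorm (x - y) y
  have h4 := norm_sub_norm_le (hs.tensorRep hC y) (hs.tensorRep hC x)
  rw [norm_sub_rev, ← map_sub] at h4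
  rw [sub_add_cancel] at h3
  linarith

/-- The *-homomorphism of the C*-tensor product defined by `tensorRep`. -/
def cstarTensorRep (hC : ∀ c ∈ C, ∀ i, Commute c (s i)) : CStarTensor (UHF d) C →⋆ₐ[ℂ] Q :=
  CStarSeminorm.lift (hs.tensorRep hC) (norm_le_tensorSeminorm _)

theorem norm_cstarTensorRep (hC : ∀ c ∈ C, ∀ i, Commute c (s i)) (x : CStarTensor (UHF d) C) :
    ‖hs.cstarTensorRep hC x‖ = ‖x‖ :=
  CStarSeminorm.norm_lift _ (hs.tensorSeminorm_le hC) x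

theorem cstarTensorRep_injective (hC : ∀ c ∈ C, ∀ i, Commute c (s i)) :
    Function.Injective (hs.cstarTensorRep hC) :=
  (injective_iff_map_eq_zero _).2 fun x hx => by
    rw [← norm_eq_zero, ← hs.norm_cstarTensorRep hC, hx, norm_zero]

/-- Elementary tensors are approximated from `M_{dⁿ} ⊗ C`, which maps into level `n`. Conversely
each `s_α c s_β*` is the image of `e_{αβ} ⊗ c`, and the range is closed. -/
theorem range_cstarTensorRep (hC : ∀ c ∈ C, ∀ i, Commute c (s i)) :
    Set.range (hs.cstarTensorRep hC) = closure (⋃ n, (hs.level C n : Set Q)) := by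
  have hcont : Continuous (hs.cstarTensorRep hC) := CStarSeminorm.continuous_lift _
  apply subset_antisymm
  · rintro _ ⟨x, rfl⟩
    refine (tensorSeminorm (UHF d) C).completion_induction
      (P := fun x => hs.cstarTensorRep hC x ∈ closure (⋃ n, (hs.level C n : Set Q))) x
      (isClosed_closure.preimage hcont) fun a => ?_
    rw [cstarTensorRep, CStarSeminorm.lift_toCompletion]
    refine Metric.mem_closure_iff.2 fun ε hε => ?_
    obtain ⟨N, hN⟩ := exists_tensorLevel_near a hε
    obtain ⟨y, hy, hay⟩ := hN N le_rfl
    obtain ⟨b, hb, -⟩ := hs.exists_levelToTensor_eq hC hy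
    refine ⟨b, Set.mem_iUnion.2 ⟨N, b.2⟩, ?_⟩
    rw [hb, dist_eq_norm, ← map_sub]
    exact (norm_le_tensorSeminorm (hs.tensorRep hC) _).trans_lt hay
  · refine closure_minimal ?_ (isClosed_range_starAlgHom _)
    refine Set.iUnion_subset fun n y hy => ?_
    rw [hs.eq_sum_corner n n y]
    change _ ∈ (hs.cstarTensorRep hC).range
    refine sum_mem fun α _ => sum_mem fun β _ => ?_
    refine ⟨(tensorSeminorm (UHF d) C).toCompletion
      (toDirectLimit (matrixEmbedding d) n (matrixUnit α β) ⊗ₜ hs.corner α β ⟨y, hy⟩), ?_⟩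
    change hs.cstarTensorRep hC _ = _
    rw [cstarTensorRep, CStarSeminorm.lift_toCompletion, tensorRep_tmul, uhfRep_toDirectLimit,
      matrixRep_matrixUnit, mul_assoc, mul_assoc (word s n α),
      ← (commute_star_word hC (hs.corner α β ⟨y, hy⟩).2 n β).eq]
    rfl

theorem nonempty_starAlgEquiv (hC : ∀ c ∈ C, ∀ i, Commute c (s i)) (L : StarSubalgebra ℂ Q)
    (hL : (L : Set Q) = closure (⋃ n, (hs.level C n : Set Q))) :
    Nonempty (L ≃⋆ₐ[ℂ] CStarTensor (UHF d) C) := by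
  have hr : (hs.cstarTensorRep hC).range = L :=
    SetLike.coe_injective ((hs.range_cstarTensorRep hC).trans hL.symm)
  let e := StarAlgEquiv.ofInjective (hs.cstarTensorRep hC) (hs.cstarTensorRep_injective hC)
  rw [← hr]
  exact ⟨e.symm⟩

end IsCuntz

end TensorRep

/-! ### Compressions of closed ideals by the Cuntz isometries -/

theorem norm_le_one_of_star_mul_self {Q : Type*} [CStarAlgebra Q] {x : Q} (h : star x * x = 1) :
    ‖x‖ ≤ 1 := by
  nontriviality Q
  have h1 := CStarRing.norm_star_mul_self (x := x)
  rw [h, norm_one] at h1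
  nlinarith [norm_nonneg x]

section Invariance

variable {Q : Type*} [CStarAlgebra Q] {d : ℕ} {s : Fin d → Q} {C : StarSubalgebra ℂ Q}

/-- The element `∑_γ s_γ x s_γ*`, where `γ` runs through the words of length `m`. -/
def wordShift (s : Fin d → Q) (m : ℕ) (x : Q) : Q := ∑ γ, word s m γ * x * star (word s m γ)

theorem star_wordShift (m : ℕ) (x : Q) : star (wordShift s m x) = wordShift s m (star x) := by
  simp [wordShift, star_sum, mul_assoc]

namespace IsCuntz

variable (hs : IsCuntz s)
include hs

theorem wordShift_mul_word (m : ℕ) (x : Q) (α : Fin m → Fin d) :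
    wordShift s m x * word s m α = word s m α * x := by
  simp only [wordShift, Finset.sum_mul, mul_assoc, hs.star_word_mul_word]
  simp

theorem star_word_mul_wordShift (m : ℕ) (x : Q) (α : Fin m → Fin d) :
    star (word s m α) * wordShift s m x = x * star (word s m α) := by
  have := congrArg star (hs.wordShift_mul_word m (star x) α)
  simpa [star_wordShift] using this

theorem wordShift_mul (m : ℕ) (x y : Q) :
    wordShift s m x * wordShift s m y = wordShift s m (x * y) := by
  conv_lhs => rw [wordShift, Finset.sum_mul]
  simp only [mul_assoc, hs.star_word_mul_wordShift]
  simp only [wordShift, mul_assoc]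

theorem wordShift_one (m : ℕ) : wordShift s m 1 = 1 := by
  simp [wordShift, hs.sum_word_mul_star]

/-- Both products have the `(α, β)` corner `c sₖ = sₖ c`, where `c ∈ C` is the corner of `y`. -/
theorem commute_wordShift (hC : ∀ c ∈ C, ∀ i, Commute c (s i)) {m : ℕ} {y : Q}
    (hy : y ∈ hs.level C m) (k : Fin d) : Commute y (wordShift s m (s k)) := by
  change _ = _
  rw [hs.eq_sum_corner m m (y * _), hs.eq_sum_corner m m (wordShift s m (s k) * y)]
  refine Finset.sum_congr rfl fun α _ => Finset.sum_congr rfl fun β _ => ?_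
  congr 2
  rw [mul_assoc, mul_assoc, hs.wordShift_mul_word, ← mul_assoc, ← mul_assoc, ← mul_assoc,
    hs.star_word_mul_wordShift, (hC _ (hy α β) k).eq]
  simp only [mul_assoc]

theorem norm_le_one (i : Fin d) : ‖s i‖ ≤ 1 :=
  norm_le_one_of_star_mul_self (by rw [hs.orthonormal, if_pos rfl])

theorem norm_wordShift_le_one (m : ℕ) (k : Fin d) : ‖wordShift s m (s k)‖ ≤ 1 :=
  norm_le_one_of_star_mul_self (by
    rw [star_wordShift, hs.wordShift_mul, hs.orthonormal, if_pos rfl, hs.wordShift_one])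

/-- It is the sum over `γ` of `s_{γk} s_{iγ}*`, with both words of length `m + 1`. -/
theorem wordShift_mul_star_mem_level (m : ℕ) (i k : Fin d) :
    wordShift s m (s k) * star (s i) ∈ hs.level C (m + 1) := by
  rw [wordShift, Finset.sum_mul]
  refine sum_mem fun γ _ => ?_
  have := hs.word_mul_mul_star_word_mem_level (C := C) (Fin.snoc (α := fun _ => Fin d) γ k)
    (Fin.cons (α := fun _ => Fin d) i γ) (one_mem C)
  rwa [word_snoc, word_cons, mul_one, star_mul, ← mul_assoc] at this

theorem star_mul_mul_mem_level {m : ℕ} {b : Q} (hb : b ∈ hs.level C (m + 1)) (i j : Fin d) :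
    star (s i) * b * s j ∈ hs.level C m := fun α β => by
  have := hb (Fin.cons (α := fun _ => Fin d) i α) (Fin.cons (α := fun _ => Fin d) j β)
  rw [word_cons, word_cons, star_mul] at this
  simpa only [mul_assoc] using this

/-- The compression `sᵢ* b sⱼ` lies in level `m`, so it commutes with the elements `wordShift s m (s
k)`. These again satisfy `∑ₖ tₖ tₖ* = 1`, because `wordShift s m` is multiplicative, unital and
compatible with the star. The right-hand side involves only multiplications by elements of level `m
+ 1`. -/
theorem star_mul_mul_eq_sum (hC : ∀ c ∈ C, ∀ i, Commute c (s i)) {m : ℕ} {b : Q}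
    (hb : b ∈ hs.level C (m + 1)) (i j : Fin d) :
    star (s i) * b * s j = ∑ k, (wordShift s m (s k) * star (s i)) * b *
      star (wordShift s m (s k) * star (s j)) := by
  have h1 : ∑ k, wordShift s m (s k) * star (wordShift s m (s k)) = 1 := by
    simp only [star_wordShift, hs.wordShift_mul]
    rw [← hs.wordShift_one m, ← hs.sum_mul_star]
    simp only [wordShift, Finset.mul_sum, Finset.sum_mul]
    exact Finset.sum_comm
  conv_lhs => rw [← mul_one (star (s i) * b * s j), ← h1, Finset.mul_sum]
  refine Finset.sum_congr rfl fun k _ => ?_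
  rw [← mul_assoc, (hs.commute_wordShift hC (hs.star_mul_mul_mem_level hb i j) k).eq, star_mul,
    star_star]
  simp only [mul_assoc]

end IsCuntz

/-- The image in `Q` of an ideal of a subalgebra of `Q`. -/
def idealImage {L : StarSubalgebra ℂ Q} (J : TwoSidedIdeal L) : AddSubgroup Q :=
  (TwoSidedIdeal.asIdeal J).toAddSubgroup.map (L.subtype : L →+ Q)

theorem mul_mul_mem_idealImage {L : StarSubalgebra ℂ Q} {J : TwoSidedIdeal L} {x y q : Q}
    (hx : x ∈ L) (hy : y ∈ L) (hq : q ∈ idealImage J) : x * q * y ∈ idealImage J := by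
  obtain ⟨b, hb, rfl⟩ := hq
  exact ⟨⟨x, hx⟩ * b * ⟨y, hy⟩, J.mul_mem_right _ _ (J.mul_mem_left _ _ hb), rfl⟩

theorem isClosed_idealImage {L : StarSubalgebra ℂ Q} (hL : IsClosed (L : Set Q))
    {J : TwoSidedIdeal L} (hJ : IsClosed (J : Set L)) : IsClosed (idealImage J : Set Q) :=
  hL.isClosedMap_subtype_val _ hJ

namespace IsCuntz

variable (hs : IsCuntz s) (hC : ∀ c ∈ C, ∀ i, Commute c (s i)) {L : StarSubalgebra ℂ Q}
  (hL : (L : Set Q) = closure (⋃ n, (hs.level C n : Set Q)))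
  {J : TwoSidedIdeal L} (hJ : IsClosed (J : Set L))
include hC hL hJ

/-- Approximate `a` by an element `b` of some level. The sum of `star_mul_mul_eq_sum`, formed with
`a` in place of `b`, lies in `J` and is close to `sᵢ* a sⱼ`; closedness of `J` concludes. -/
theorem star_mul_mul_mem_idealImage {a : Q} (ha : a ∈ idealImage J) (i j : Fin d) :
    star (s i) * a * s j ∈ idealImage J := by
  have hLc : IsClosed (L : Set Q) := hL ▸ isClosed_closure
  have hlev : ∀ {n : ℕ} {y : Q}, y ∈ hs.level C n → y ∈ L := fun {n y} hy => by
    change y ∈ (L : Set Q)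
    rw [hL]
    exact subset_closure (Set.mem_iUnion.2 ⟨n, hy⟩)
  refine (isClosed_idealImage hLc hJ).closure_subset (Metric.mem_closure_iff.2 fun ε hε => ?_)
  have haL : a ∈ closure (⋃ n, (hs.level C n : Set Q)) := by
    obtain ⟨b, -, rfl⟩ := ha
    rw [← hL]
    exact b.2
  -- The final error consists of `1 + d` terms of norm at most `‖a - b‖`: the compression itself and
  -- the `d` summands.
  obtain ⟨b, hb, hab⟩ := Metric.mem_closure_iff.1 haL (ε / (1 + d)) (by positivity)
  obtain ⟨n, hn⟩ := Set.mem_iUnion.1 hb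
  have hn' : b ∈ hs.level C (n + 1) := hs.level_mono hC n.le_succ hn
  have hmul : ∀ {x y z : Q}, ‖x‖ ≤ 1 → ‖y‖ ≤ 1 → ‖x * z * y‖ ≤ ‖z‖ := fun {x y z} hx hy => by
    have h1 := norm_mul_le (x * z) y
    have h2 := norm_mul_le x z
    nlinarith [norm_nonneg z, norm_nonneg (x * z)]
  have hw : ∀ k l, ‖wordShift s n (s k) * star (s l)‖ ≤ 1 := fun k l =>
    (norm_mul_le _ _).trans (mul_le_one₀ (hs.norm_wordShift_le_one n k) (norm_nonneg _)
      ((norm_star _).trans_le (hs.norm_le_one l)))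
  refine ⟨∑ k, (wordShift s n (s k) * star (s i)) * a *
      star (wordShift s n (s k) * star (s j)), sum_mem fun k _ => mul_mul_mem_idealImage
      (hlev (hs.wordShift_mul_star_mem_level n i k))
      (star_mem (hlev (hs.wordShift_mul_star_mem_level n j k))) ha, ?_⟩
  rw [dist_eq_norm] at hab ⊢
  have key : star (s i) * a * s j - ∑ k, (wordShift s n (s k) * star (s i)) * a *
      star (wordShift s n (s k) * star (s j)) = star (s i) * (a - b) * s j -
      ∑ k, (wordShift s n (s k) * star (s i)) * (a - b) *
        star (wordShift s n (s k) * star (s j)) := by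
    simp only [mul_sub, sub_mul, Finset.sum_sub_distrib]
    rw [← hs.star_mul_mul_eq_sum hC hn' i j]
    abel
  rw [key]
  calc _ ≤ ‖star (s i) * (a - b) * s j‖ + ‖∑ k, (wordShift s n (s k) * star (s i)) * (a - b) *
        star (wordShift s n (s k) * star (s j))‖ := norm_sub_le _ _
    _ ≤ ‖a - b‖ + ∑ _k : Fin d, ‖a - b‖ := by
      refine add_le_add (hmul ((norm_star _).trans_le (hs.norm_le_one i)) (hs.norm_le_one j))
        (norm_sum_le_of_le _ fun k _ => hmul (hw k i) ((norm_star _).trans_le (hw k j)))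
    _ = ‖a - b‖ * (1 + d) := by simp; ring
    _ < ε := (lt_div_iff₀ (by positivity)).1 hab

/-- Expanding `x = ∑ sᵢ(sᵢ*x)` and `y` likewise leaves the elements `(sᵢ*x)* (sᵢ* a sⱼ) (sⱼ*y)`,
whose outer factors lie in `L`. -/
theorem star_mul_mul_mem_ideal {x y : Q} (hx : ∀ i, star (s i) * x ∈ L)
    (hy : ∀ i, star (s i) * y ∈ L) {a : Q} (ha : a ∈ idealImage J) :
    star x * a * y ∈ idealImage J := by
  have h : ∀ v : Q, v = ∑ i, s i * (star (s i) * v) := fun v => by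
    simp only [← mul_assoc, ← Finset.sum_mul, hs.sum_mul_star, one_mul]
  rw [h x, h y]
  simp only [star_sum, Finset.sum_mul, Finset.mul_sum]
  refine sum_mem fun j _ => sum_mem fun i _ => ?_
  have := mul_mul_mem_idealImage (star_mem (hx i)) (hy j)
    (hs.star_mul_mul_mem_idealImage hC hL hJ ha i j)
  simpa [mul_assoc] using this

end IsCuntz

end Invariance

/-! ### Shifts and diagonal operators on the Fock space -/

section FockOperators

variable {d : ℕ}

theorem fock_ext {ξ η : Fock d} (h : ∀ k, ξ k = η k) : ξ = η := lp.ext (funext h)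

theorem clm_fock_ext {S T : Fock d →L[ℂ] Fock d} (h : ∀ ξ k, S ξ k = T ξ k) : S = T :=
  ContinuousLinearMap.ext fun ξ => fock_ext (h ξ)

theorem shift_apply_zero (i : Fin d) (ξ : Fock d) : shift i ξ 0 = 0 := rfl

theorem shift_apply_succ (i : Fin d) (ξ : Fock d) (k : ℕ) :
    shift i ξ (k + 1) = basisTensor i (ξ k) := rfl

theorem basisTensor_zero (i : Fin d) (k : ℕ) : basisTensor i (0 : Level d k) = 0 := by
  ext α; simp [basisTensor_apply]

theorem shift_single (i : Fin d) (k : ℕ) (v : Level d k) :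
    shift i (lp.single 2 k v) = lp.single 2 (k + 1) (basisTensor i v) := by
  refine fock_ext fun m => ?_
  cases m with
  | zero => rw [shift_apply_zero, lp.single_apply_ne _ _ _ (by omega)]
  | succ m =>
    rw [shift_apply_succ]
    by_cases h : m = k
    · subst h; rw [lp.single_apply_self, lp.single_apply_self]
    · rw [lp.single_apply_ne _ _ _ h, lp.single_apply_ne _ _ _ (by omega), basisTensor_zero]

theorem basisTensor_single (i : Fin d) (k : ℕ) (β : Fin k → Fin d) :
    basisTensor i (EuclideanSpace.single β (1 : ℂ)) =
      EuclideanSpace.single (Fin.cons (α := fun _ => Fin d) i β) 1 := by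
  ext α
  have h : α = Fin.cons (α := fun _ => Fin d) i β ↔ α 0 = i ∧ Fin.tail α = β := by
    conv_lhs => rw [← Fin.cons_self_tail α]
    exact Fin.cons_inj
  simp only [basisTensor_apply, PiLp.single_apply, h]
  split_ifs <;> simp_all

/-- Coordinates are inner products with basis vectors, and `Sᵢ` sends the basis vector of `β` to
that of `iβ`. -/
theorem star_shift_apply (i : Fin d) (ξ : Fock d) (k : ℕ) (β : Fin k → Fin d) :
    star (shift i) ξ k β = ξ (k + 1) (Fin.cons (α := fun _ => Fin d) i β) := by
  have h1 : ∀ (m : ℕ) (γ : Fin m → Fin d) (η : Fock d),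
      inner ℂ (lp.single 2 m (EuclideanSpace.single γ (1 : ℂ)) : Fock d) η = η m γ := by
    intro m γ η
    rw [lp.inner_single_left, EuclideanSpace.inner_single_left]
    simp
  rw [← h1, ContinuousLinearMap.star_eq_adjoint, ContinuousLinearMap.adjoint_inner_right,
    shift_single, basisTensor_single, h1]

theorem star_shift_mul_shift (i j : Fin d) :
    star (shift i) * shift j = if i = j then 1 else 0 := by
  refine clm_fock_ext fun ξ k => ?_
  ext β
  change star (shift i) (shift j ξ) k β = _
  rw [star_shift_apply, shift_apply_succ, basisTensor_apply, Fin.cons_zero, Fin.tail_cons]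
  split_ifs <;> rfl

theorem norm_diagonal_le {A : ∀ k, Level d k →L[ℂ] Level d k} (hA : ∃ C : ℝ, ∀ k, ‖A k‖ ≤ C)
    {c : ℝ} (hc : ∀ k, ‖A k‖ ≤ c) : ‖diagonal A hA‖ ≤ c := by
  have h : diagonal A hA = lp.mapCLM 2 A ((norm_nonneg _).trans (hc 0)) hc := rfl
  rw [h]
  exact lp.norm_mapCLM_le ..

/-- The levels are finite-dimensional, so the truncations have finite rank; they converge in norm.
-/
theorem isCompactOperator_diagonal {A : ∀ k, Level d k →L[ℂ] Level d k}
    (hA : ∃ C : ℝ, ∀ k, ‖A k‖ ≤ C) (h : Tendsto (fun k => ‖A k‖) atTop (𝓝 0)) :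
    IsCompactOperator (diagonal A hA) := by
  have hcl : IsClosed {f : Fock d →L[ℂ] Fock d | IsCompactOperator f} :=
    isClosed_setOfPred_isCompactOperator
  refine hcl.closure_subset (Metric.mem_closure_iff.2 fun ε hε => ?_)
  obtain ⟨N, hN⟩ := eventually_atTop.1 (h.eventually (gt_mem_nhds (half_pos hε)))
  let T : ℕ → Fock d →L[ℂ] Fock d := fun k =>
    (lp.singleContinuousLinearMap ℂ (fun k => Level d k) 2 k ∘L A k) ∘L
      lp.evalCLM ℂ (fun k => Level d k) 2 k
  have hT : ∀ (ξ : Fock d) k m, T k ξ m = if k = m then A m (ξ m) else 0 := by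
    intro ξ k m
    change lp.single 2 k (A k (ξ k)) m = _
    split_ifs with hkm
    · subst hkm; rw [lp.single_apply_self]
    · rw [lp.single_apply_ne _ _ _ (Ne.symm hkm)]
  refine ⟨∑ k ∈ Finset.range N, T k, ?_, ?_⟩
  · change _ ∈ compactIdeal (Fock d)
    refine sum_mem fun k _ => ?_
    change IsCompactOperator (T k)
    have : IsCompactOperator (lp.singleContinuousLinearMap ℂ (fun k => Level d k) 2 k ∘L A k) :=
      (isCompactOperator_of_locallyCompactSpace_dom (A k)).clm_comp
        (lp.singleContinuousLinearMap ℂ (fun k => Level d k) 2 k)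
    exact this.comp_clm _
  · have hB : ∀ k, ‖if k < N then (0 : Level d k →L[ℂ] Level d k) else A k‖ ≤ ε / 2 := by
      intro k
      split_ifs with hk
      · rw [norm_zero]; positivity
      · exact (hN k (not_lt.1 hk)).le
    have hd : diagonal A hA - ∑ k ∈ Finset.range N, T k = diagonal _ ⟨_, hB⟩ := by
      refine clm_fock_ext fun ξ m => ?_
      have hs : ∀ t : Finset ℕ, (∑ k ∈ t, T k) ξ m = if m ∈ t then A m (ξ m) else 0 := by
        intro t
        have : (∑ k ∈ t, T k) ξ m = ∑ k ∈ t, T k ξ m := by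
          rw [sum_apply, lp.coeFn_sum, Finset.sum_apply]
        rw [this]
        simp [hT]
      rw [sub_apply, lp.coeFn_sub, Pi.sub_apply, hs, diagonal_apply,
        diagonal_apply]
      simp only [Finset.mem_range]
      split_ifs <;> simp
    rw [dist_eq_norm, hd]
    exact (norm_diagonal_le _ hB).trans_lt (half_lt_self hε)

/-- The projection `P₀` onto the vacuum. -/
def vacuumProjection (d : ℕ) : Fock d →L[ℂ] Fock d :=
  diagonal (fun k => if k = 0 then 1 else 0) ⟨1, fun k => by
    split_ifs
    · exact ContinuousLinearMap.norm_id_le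
    · simp⟩

theorem isCompactOperator_vacuumProjection : IsCompactOperator (vacuumProjection d) := by
  refine isCompactOperator_diagonal _ (tendsto_const_nhds.congr' ?_)
  filter_upwards [eventually_gt_atTop 0] with k hk
  rw [if_neg hk.ne', norm_zero]

/-- `SᵢSᵢ*` projects onto the words beginning with `i`; only the empty word is missed. -/
theorem sum_shift_mul_star : ∑ i, shift i * star (shift i) = 1 - vacuumProjection d := by
  refine clm_fock_ext fun ξ k => ?_
  have h : (∑ i : Fin d, shift i * star (shift i)) ξ k = ∑ i, shift i (star (shift i) ξ) k := by
    rw [sum_apply, lp.coeFn_sum, Finset.sum_apply]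
    rfl
  rw [h, sub_apply, lp.coeFn_sub, Pi.sub_apply, vacuumProjection,
    diagonal_apply]
  cases k with
  | zero => simp [shift_apply_zero]
  | succ k =>
    ext α
    simp only [shift_apply_succ]
    have : (∑ i, basisTensor i (star (shift i) ξ k)) α =
      ∑ i, basisTensor i (star (shift i) ξ k) α := by simp
    rw [this]
    simp [basisTensor_apply, star_shift_apply]

/-- The images of the shifts in the Calkin algebra. -/
def calkinShift (i : Fin d) : Calkin (Fock d) := calkinMap (Fock d) (shift i)

theorem calkinMap_eq_iff {S T : Fock d →L[ℂ] Fock d} :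
    calkinMap (Fock d) S = calkinMap (Fock d) T ↔ IsCompactOperator (S - T) := calkinMk_eq_iff

theorem isCuntz_calkinShift : IsCuntz (calkinShift (d := d)) where
  orthonormal i j := by
    rw [calkinShift, calkinShift, ← map_star, ← map_mul, star_shift_mul_shift]
    split_ifs <;> simp
  sum_mul_star := by
    simp only [calkinShift, ← map_star, ← map_mul, ← map_sum]
    rw [← map_one (calkinMap (Fock d)), calkinMap_eq_iff, sum_shift_mul_star]
    simpa using isCompactOperator_vacuumProjection.neg

end FockOperators

/-! ### Condition A(1): the weight commutes with the shifts modulo compacts -/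

namespace WeightSequence

variable {d : ℕ} (Z : WeightSequence d)

theorem weight_apply (ξ : Fock d) (k : ℕ) : Z.weight ξ k = Z.op k (ξ k) := rfl

variable {Z}

theorem z_mul_calkinShift (hA : Z.ConditionA 1) (i : Fin d) :
    Z.z * calkinShift i = calkinShift i * Z.z := by
  rw [z, calkinShift, ← map_mul, ← map_mul, calkinMap_eq_iff]
  -- The commutator of `Z` and `Sᵢ` is the diagonal operator of `R` times `Sᵢ`. The value at level 0
  -- is immaterial because `Sᵢ` has no component there.
  let R : ∀ k, Level d k →L[ℂ] Level d k
    | 0 => 0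
    | k + 1 => Z.op (k + 1) - oneTensor (Z.op k)
  have hlim : Tendsto (fun k => ‖R k‖) atTop (𝓝 0) := by
    rw [← tendsto_add_atTop_iff_nat 1]
    exact hA.congr fun k => norm_sub_rev _ _
  obtain ⟨c, hc⟩ := hlim.bddAbove_range
  have hR : ∃ c : ℝ, ∀ k, ‖R k‖ ≤ c := ⟨c, fun k => hc ⟨k, rfl⟩⟩
  have : Z.weight * shift i - shift i * Z.weight = diagonal R hR * shift i := by
    refine clm_fock_ext fun ξ k => ?_
    rw [sub_apply, lp.coeFn_sub, Pi.sub_apply]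
    change Z.weight (shift i ξ) k - shift i (Z.weight ξ) k = diagonal R hR (shift i ξ) k
    rw [diagonal_apply, weight_apply]
    cases k with
    | zero => simp [shift_apply_zero, R]
    | succ k =>
      rw [shift_apply_succ, shift_apply_succ, weight_apply, ← oneTensor_basisTensor]
      rfl
  rw [this]
  exact (isCompactOperator_diagonal hR hlim).comp_clm _

/-- Commutation of `z` with the `sⱼ` gives `z = ∑ sⱼ z sⱼ*`, whence `sᵢ* z = z sᵢ*`; take adjoints.
Normality of `z` plays no role. -/
theorem star_z_mul_calkinShift (hA : Z.ConditionA 1) (i : Fin d) :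
    star Z.z * calkinShift i = calkinShift i * star Z.z := by
  have h := isCuntz_calkinShift (d := d)
  have hz : Z.z = ∑ j, calkinShift j * Z.z * star (calkinShift j) := by
    simp only [← z_mul_calkinShift hA, mul_assoc, ← Finset.mul_sum, h.sum_mul_star, mul_one]
  have : star (calkinShift i) * Z.z = Z.z * star (calkinShift i) := by
    conv_lhs => rw [hz]
    simp only [Finset.mul_sum, ← mul_assoc, h.orthonormal]
    simp
  simpa using congrArg star this

theorem commute_calkinShift (hA : Z.ConditionA 1) (c : Calkin (Fock d))
    (hc : c ∈ StarAlgebra.elemental ℂ Z.z) (i : Fin d) : Commute c (calkinShift i) := by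
  have hcl : IsClosed {c : Calkin (Fock d) | Commute c (calkinShift i)} :=
    isClosed_eq (f := fun c => c * calkinShift i) (g := fun c => calkinShift i * c)
      (by fun_prop) (by fun_prop)
  refine closure_minimal ?_ hcl (show c ∈ closure _ from hc)
  intro c hc
  change c ∈ StarAlgebra.adjoin ℂ {Z.z} at hc
  rw [← StarSubalgebra.mem_toSubalgebra, StarAlgebra.adjoin_toSubalgebra] at hc
  have : Algebra.adjoin ℂ ({Z.z} ∪ star {Z.z}) ≤ Subalgebra.centralizer ℂ {calkinShift i} := by
    refine Algebra.adjoin_le ?_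
    rintro x (rfl | hx) _ rfl
    · exact (z_mul_calkinShift hA i).symm
    · rw [Set.star_singleton] at hx
      obtain rfl := hx
      exact (star_z_mul_calkinShift hA i).symm
  exact (this hc _ rfl).symm

end WeightSequence

/-! ### Homogeneous operators and averages over the gauge action -/

section Gauge

variable {d : ℕ}

theorem norm_gaugeOperator_le (t : ℝ) : ‖gaugeOperator d t‖ ≤ 1 :=
  norm_diagonal_le _ fun n => by
    refine (norm_smul_le (Complex.exp (Complex.I * n * t)) (1 : Level d n →L[ℂ] Level d n)).trans ?_
    have h : ‖Complex.exp (Complex.I * n * t)‖ = 1 := by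
      rw [Complex.norm_exp]; simp
    rw [h, one_mul]
    exact ContinuousLinearMap.norm_id_le

theorem norm_gauge_le (t : ℝ) (X : Fock d →L[ℂ] Fock d) : ‖gauge d t X‖ ≤ ‖X‖ := by
  have h1 := norm_mul_le (gaugeOperator d t * X) (star (gaugeOperator d t))
  have h2 := norm_mul_le (gaugeOperator d t) X
  have h3 := norm_gaugeOperator_le (d := d) t
  have h4 : ‖star (gaugeOperator d t)‖ ≤ 1 := by
    rw [star_gaugeOperator]
    exact norm_gaugeOperator_le _
  rw [gauge]
  nlinarith [norm_nonneg X, norm_nonneg (gaugeOperator d t * X)]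

theorem continuous_gauge (t : ℝ) : Continuous (gauge d t) := by
  unfold gauge
  fun_prop

/-- `X` is homogeneous of degree `m` for the gauge action. -/
def IsHomogeneous (m : ℤ) (X : Fock d →L[ℂ] Fock d) : Prop :=
  ∀ t : ℝ, gauge d t X = Complex.exp (Complex.I * m * t) • X

namespace IsHomogeneous

variable {m n : ℤ} {X Y : Fock d →L[ℂ] Fock d}

theorem mul (hX : IsHomogeneous m X) (hY : IsHomogeneous n Y) : IsHomogeneous (m + n) (X * Y) :=
  fun t => by
    rw [gauge_mul, hX, hY, smul_mul_smul_comm, ← Complex.exp_add]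
    push_cast
    ring_nf

theorem star (hX : IsHomogeneous m X) : IsHomogeneous (-m) (star X) := fun t => by
  rw [gauge_star, hX, star_smul]
  congr 1
  change (starRingEnd ℂ) _ = _
  rw [← Complex.exp_conj]
  simp

theorem one : IsHomogeneous 0 (1 : Fock d →L[ℂ] Fock d) := fun t => by simp [gauge_one]

end IsHomogeneous

theorem isHomogeneous_zero_iff {X : Fock d →L[ℂ] Fock d} :
    IsHomogeneous 0 X ↔ ∀ t : ℝ, gauge d t X = X := by simp [IsHomogeneous]

theorem isHomogeneous_diagonal {A : ∀ k, Level d k →L[ℂ] Level d k}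
    (hA : ∃ C : ℝ, ∀ k, ‖A k‖ ≤ C) : IsHomogeneous 0 (diagonal A hA) := by
  refine isHomogeneous_zero_iff.2 fun t => clm_fock_ext fun ξ k => ?_
  rw [gauge, star_gaugeOperator]
  change gaugeOperator d t (diagonal A hA (gaugeOperator d (-t) ξ)) k = _
  rw [gaugeOperator_apply, diagonal_apply, gaugeOperator_apply, map_smul, smul_smul,
    ← Complex.exp_add, diagonal_apply]
  simp

theorem isHomogeneous_shift (i : Fin d) : IsHomogeneous 1 (shift i) := by
  refine fun t => clm_fock_ext fun ξ k => ?_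
  rw [gauge, star_gaugeOperator]
  change gaugeOperator d t (shift i (gaugeOperator d (-t) ξ)) k =
    Complex.exp (Complex.I * (1 : ℤ) * t) • shift i ξ k
  rw [gaugeOperator_apply]
  cases k with
  | zero => rw [shift_apply_zero, shift_apply_zero, smul_zero, smul_zero]
  | succ k =>
    rw [shift_apply_succ, shift_apply_succ, gaugeOperator_apply]
    ext α
    simp only [PiLp.smul_apply, basisTensor_apply]
    split_ifs
    · rw [smul_smul, ← Complex.exp_add]
      congr 2
      push_cast
      ring
    · simp

theorem isHomogeneous_word (n : ℕ) (α : Fin n → Fin d) :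
    IsHomogeneous n (word shift n α) := by
  induction n with
  | zero => exact IsHomogeneous.one
  | succ n ih =>
    rw [Nat.cast_succ]
    exact (ih _).mul (isHomogeneous_shift _)

/-- The average of `γ_t(X)` over the `N`-th parts `t` of `2π`. -/
def gaugeAverage (N : ℕ) (X : Fock d →L[ℂ] Fock d) : Fock d →L[ℂ] Fock d :=
  (N : ℂ)⁻¹ • ∑ j ∈ Finset.range N, gauge d (2 * Real.pi * j / N) X

theorem gaugeAverage_add (N : ℕ) (X Y : Fock d →L[ℂ] Fock d) :
    gaugeAverage N (X + Y) = gaugeAverage N X + gaugeAverage N Y := by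
  simp only [gaugeAverage, gauge_add, Finset.sum_add_distrib, smul_add]

theorem gaugeAverage_smul (N : ℕ) (r : ℂ) (X : Fock d →L[ℂ] Fock d) :
    gaugeAverage N (r • X) = r • gaugeAverage N X := by
  simp only [gaugeAverage, gauge_smul, ← Finset.smul_sum]
  rw [smul_comm]

theorem norm_gaugeAverage_le (N : ℕ) (X : Fock d →L[ℂ] Fock d) :
    ‖gaugeAverage N X‖ ≤ ‖X‖ := by
  rw [gaugeAverage, norm_smul, norm_inv, RCLike.norm_natCast]
  have h : ‖∑ j ∈ Finset.range N, gauge d (2 * Real.pi * j / N) X‖ ≤ N * ‖X‖ := by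
    refine (norm_sum_le_of_le _ fun j _ => norm_gauge_le _ X).trans_eq ?_
    simp
  rcases N.eq_zero_or_pos with rfl | hN
  · simp
  · have hN' : (0 : ℝ) < N := by exact_mod_cast hN
    rwa [inv_mul_le_iff₀ hN']

theorem gaugeAverage_of_isHomogeneous_zero {N : ℕ} (hN : 0 < N) {X : Fock d →L[ℂ] Fock d}
    (hX : IsHomogeneous 0 X) : gaugeAverage N X = X := by
  have hN' : (N : ℂ) ≠ 0 := by exact_mod_cast hN.ne'
  simp only [gaugeAverage, isHomogeneous_zero_iff.1 hX, Finset.sum_const, Finset.card_range]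
  rw [← Nat.cast_smul_eq_nsmul ℂ, smul_smul, inv_mul_cancel₀ hN', one_smul]

/-- The average is a geometric sum of powers of `ζ = exp(2πim/N)`. It vanishes because `ζ^N = 1`
while `ζ ≠ 1`, as `0 < |m| < N` prevents `N` from dividing `m`. A finite average thus replaces the
integral over the circle. -/
theorem gaugeAverage_of_isHomogeneous {N : ℕ} {m : ℤ} (hm : m ≠ 0) (hN : m.natAbs < N)
    {X : Fock d →L[ℂ] Fock d} (hX : IsHomogeneous m X) : gaugeAverage N X = 0 := by
  have hN' : (N : ℂ) ≠ 0 := by exact_mod_cast (by omega : N ≠ 0)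
  have hpi : (2 * Real.pi * Complex.I : ℂ) ≠ 0 := Complex.two_pi_I_ne_zero
  let ζ := Complex.exp (m / N * (2 * Real.pi * Complex.I))
  have hζ : ζ ≠ 1 := by
    rw [Ne, Complex.exp_eq_one_iff]
    rintro ⟨n, hn⟩
    have h := mul_right_cancel₀ hpi hn
    rw [div_eq_iff hN'] at h
    have h' : m = n * N := by exact_mod_cast h
    subst h'
    rw [Int.natAbs_mul, Int.natAbs_natCast] at hN
    have : n.natAbs = 0 := by nlinarith [Nat.zero_le n.natAbs]
    exact hm (by rw [Int.natAbs_eq_zero.1 this, zero_mul])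
  have hζN : ζ ^ N = 1 := by
    rw [← Complex.exp_nat_mul, Complex.exp_eq_one_iff]
    exact ⟨m, by field_simp⟩
  have hsum : ∑ j ∈ Finset.range N, ζ ^ j = 0 := by
    have := mul_neg_geom_sum ζ N
    rw [hζN, sub_self, mul_eq_zero] at this
    exact this.resolve_left (sub_ne_zero.2 hζ.symm)
  have h : ∀ j : ℕ, gauge d (2 * Real.pi * j / N) X = ζ ^ j • X := fun j => by
    rw [hX, ← Complex.exp_nat_mul]
    congr 2
    push_cast
    ring
  simp only [gaugeAverage, h, ← Finset.sum_smul, hsum, zero_smul, smul_zero]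

end Gauge

/-! ### The algebra `q(𝒟)` as the closure of the levels -/

namespace WeightSequence

variable {d : ℕ} {Z : WeightSequence d}

theorem isClosed_toeplitz : IsClosed (Z.toeplitz : Set (Fock d →L[ℂ] Fock d)) :=
  StarSubalgebra.isClosed_topologicalClosure _

theorem weightedShift_mem_toeplitz (i : Fin d) : Z.weightedShift i ∈ Z.toeplitz :=
  StarSubalgebra.le_topologicalClosure _ (StarAlgebra.subset_adjoin ℂ _ ⟨i, rfl⟩)

theorem mem_gaugeFixed {X : Fock d →L[ℂ] Fock d} :
    X ∈ Z.gaugeFixed ↔ X ∈ Z.toeplitz ∧ IsHomogeneous 0 X := by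
  rw [isHomogeneous_zero_iff]
  rfl

theorem mem_gaugeOne {X : Fock d →L[ℂ] Fock d} :
    X ∈ Z.gaugeOne ↔ X ∈ Z.toeplitz ∧ IsHomogeneous 1 X := by
  simp only [IsHomogeneous, Int.cast_one, mul_one]
  rfl

instance isClosed_gaugeFixed : IsClosed (Z.gaugeFixed : Set (Fock d →L[ℂ] Fock d)) := by
  have : (Z.gaugeFixed : Set (Fock d →L[ℂ] Fock d)) =
      (Z.toeplitz : Set (Fock d →L[ℂ] Fock d)) ∩ ⋂ t : ℝ, {X | gauge d t X = X} := by
    ext X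
    simp only [Set.mem_inter_iff, Set.mem_iInter]
    exact Iff.rfl
  rw [this]
  exact isClosed_toeplitz.inter
    (isClosed_iInter fun t => isClosed_eq (continuous_gauge t) continuous_id)

theorem mem_qD {x : Calkin (Fock d)} :
    x ∈ Z.qD ↔ ∃ X ∈ Z.gaugeFixed, calkinMap (Fock d) X = x := Iff.rfl

/-- It is the range of a *-homomorphism defined on the C*-algebra `𝒟`. -/
theorem isClosed_qD : IsClosed (Z.qD : Set (Calkin (Fock d))) := by
  have := isClosed_range_starAlgHom ((calkinMap (Fock d)).comp Z.gaugeFixed.subtype)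
  convert this using 1
  ext x
  simp only [SetLike.mem_coe, mem_qD, Set.mem_range]
  exact ⟨fun ⟨X, hX, h⟩ => ⟨⟨X, hX⟩, h⟩, fun ⟨X, h⟩ => ⟨X, X.2, h⟩⟩

theorem calkinMap_word (n : ℕ) (α : Fin n → Fin d) :
    calkinMap (Fock d) (word shift n α) = word calkinShift n α := by
  induction n with
  | zero => exact map_one _
  | succ n ih => rw [word, word, map_mul, ih]; rfl

section ShiftMem

variable (hS : ∀ i, shift i ∈ Z.toeplitz)
include hS

theorem word_shift_mem_toeplitz (n : ℕ) (α : Fin n → Fin d) :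
    word shift n α ∈ Z.toeplitz := by
  induction n with
  | zero => exact one_mem _
  | succ n ih => exact mul_mem (ih _) (hS _)

theorem vacuumProjection_mem_toeplitz : vacuumProjection d ∈ Z.toeplitz := by
  have : vacuumProjection d = 1 - ∑ i, shift i * star (shift i) := by
    rw [sum_shift_mul_star, sub_sub_cancel]
  rw [this]
  exact sub_mem (one_mem _) (sum_mem fun i _ => mul_mem (hS i) (star_mem (hS i)))

omit hS in
theorem weight_mul_vacuumProjection : Z.weight * vacuumProjection d = vacuumProjection d := by
  refine clm_fock_ext fun ξ k => ?_
  change Z.op k ((if k = 0 then (1 : Level d k →L[ℂ] Level d k) else 0) (ξ k)) =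
    (if k = 0 then (1 : Level d k →L[ℂ] Level d k) else 0) (ξ k)
  split_ifs with h
  · subst h; rw [Z.op_zero]; rfl
  · simp

/-- Since `Z₀ = 1`, splitting `1 = P₀ + ∑ SᵢSᵢ*` gives `Z = P₀ + ∑ WᵢSᵢ*`. -/
theorem weight_mem_toeplitz : Z.weight ∈ Z.toeplitz := by
  have : Z.weight = vacuumProjection d + ∑ i, Z.weightedShift i * star (shift i) := by
    simp only [weightedShift, mul_assoc, ← Finset.mul_sum, sum_shift_mul_star, mul_sub, mul_one,
      weight_mul_vacuumProjection]
    abel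
  rw [this]
  exact add_mem (vacuumProjection_mem_toeplitz hS)
    (sum_mem fun i _ => mul_mem (weightedShift_mem_toeplitz i) (star_mem (hS i)))

theorem z_mem_qD : Z.z ∈ Z.qD :=
  ⟨Z.weight, mem_gaugeFixed.2 ⟨weight_mem_toeplitz hS, isHomogeneous_diagonal _⟩, rfl⟩

/-- The term `s_α c s_β*` lifts to `S_α X S_β*` with `X ∈ 𝒟` a lift of `c`; this has degree `n + 0 -
n = 0` and lies in `𝒯`. -/
theorem level_le_qD (n : ℕ) :
    isCuntz_calkinShift.level (StarAlgebra.elemental ℂ Z.z) n ≤ Z.qD := by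
  have hC : StarAlgebra.elemental ℂ Z.z ≤ Z.qD :=
    StarAlgebra.elemental.le_of_mem isClosed_qD (z_mem_qD hS)
  intro y hy
  rw [isCuntz_calkinShift.eq_sum_corner n n y]
  refine sum_mem fun α _ => sum_mem fun β _ => ?_
  obtain ⟨X, hX, h⟩ := mem_qD.1 (hC (hy α β))
  obtain ⟨hXT, hXg⟩ := mem_gaugeFixed.1 hX
  rw [← h, ← calkinMap_word, ← calkinMap_word, ← map_star, ← map_mul, ← map_mul]
  refine mem_qD.2 ⟨_, mem_gaugeFixed.2 ⟨mul_mem (mul_mem (word_shift_mem_toeplitz hS n α) hXT)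
    (star_mem (word_shift_mem_toeplitz hS n β)), ?_⟩, rfl⟩
  simpa using ((isHomogeneous_word n α).mul hXg).mul (isHomogeneous_word n β).star

/-- A lift is `Sᵢ*X` with `X ∈ F`, of degree `-1 + 1 = 0`. -/
theorem star_calkinShift_mul_mem_qD {x : Calkin (Fock d)} (hx : x ∈ Z.qF) (i : Fin d) :
    star (calkinShift i) * x ∈ Z.qD := by
  obtain ⟨X, hX, rfl⟩ := hx
  obtain ⟨hXT, hXg⟩ := mem_gaugeOne.1 hX
  rw [calkinShift, ← map_star, ← map_mul]
  exact mem_qD.2 ⟨_, mem_gaugeFixed.2 ⟨mul_mem (star_mem (hS i)) hXT,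
    by simpa using (isHomogeneous_shift i).star.mul hXg⟩, rfl⟩

end ShiftMem

/-- Each `Wᵢ` has degree 1 and image `z sᵢ` in the corner space `(1, 0)`; products add degrees and
word lengths. For `p = q` the corner space is a level. -/
theorem exists_homogeneous_of_mem_closure (hA : Z.ConditionA 1) {Y : Fock d →L[ℂ] Fock d}
    (hY : Y ∈ Submonoid.closure (Set.range Z.weightedShift ∪ star (Set.range Z.weightedShift))) :
    ∃ p q : ℕ, IsHomogeneous (p - q) Y ∧ calkinMap (Fock d) Y ∈
      cornerSpace calkinShift (StarAlgebra.elemental ℂ Z.z) p q := by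
  have hC := commute_calkinShift hA
  have hgen : ∀ i, IsHomogeneous 1 (Z.weightedShift i) ∧ calkinMap (Fock d) (Z.weightedShift i) ∈
      cornerSpace calkinShift (StarAlgebra.elemental ℂ Z.z) 1 0 := fun i => by
    have hW : IsHomogeneous 0 Z.weight := isHomogeneous_diagonal Z.bounded
    refine ⟨by simpa [weightedShift] using hW.mul (isHomogeneous_shift i), ?_⟩
    rw [weightedShift, map_mul]
    exact isCuntz_calkinShift.generator_mem_cornerSpace hC i (StarAlgebra.elemental.self_mem ℂ _)
  induction hY using Submonoid.closure_induction with
  | mem x hx =>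
    rcases hx with ⟨i, rfl⟩ | ⟨i, hi⟩
    · exact ⟨1, 0, by simpa using (hgen i).1, (hgen i).2⟩
    · obtain rfl : star (Z.weightedShift i) = x := by rw [hi, star_star]
      refine ⟨0, 1, by simpa using (hgen i).1.star, ?_⟩
      rw [map_star]
      exact star_mem_cornerSpace (hgen i).2
  | one =>
    refine ⟨0, 0, by simpa using IsHomogeneous.one, ?_⟩
    rw [map_one]
    exact IsCuntz.mem_cornerSpace_zero (one_mem _)
  | mul x y _ _ hx hy =>
    obtain ⟨p, q, h1, h2⟩ := hx
    obtain ⟨p', q', h3, h4⟩ := hy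
    refine ⟨p + p', q' + q, ?_, ?_⟩
    · have := h1.mul h3
      convert this using 1
      push_cast
      ring
    · rw [map_mul]
      exact isCuntz_calkinShift.mul_mem_cornerSpace' hC h2 h4

/-- `Y` is a finite combination of homogeneous monomials. Once `N` exceeds all their degrees in
absolute value, only the monomials of degree zero survive the average. -/
theorem exists_gaugeAverage_mem_level (hA : Z.ConditionA 1) {Y : Fock d →L[ℂ] Fock d}
    (hY : Y ∈ StarAlgebra.adjoin ℂ (Set.range Z.weightedShift)) :
    ∃ n N₀ : ℕ, ∀ N, N₀ ≤ N → calkinMap (Fock d) (gaugeAverage N Y) ∈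
      isCuntz_calkinShift.level (StarAlgebra.elemental ℂ Z.z) n := by
  have hC := commute_calkinShift hA
  rw [← StarSubalgebra.mem_toSubalgebra, StarAlgebra.adjoin_toSubalgebra,
    ← Subalgebra.mem_toSubmodule, Algebra.adjoin_eq_span] at hY
  induction hY using Submodule.span_induction with
  | mem Y hY =>
    obtain ⟨p, q, h1, h2⟩ := exists_homogeneous_of_mem_closure hA hY
    by_cases hpq : p = q
    · subst hpq
      rw [sub_self] at h1
      refine ⟨p, 1, fun N hN => ?_⟩
      rw [gaugeAverage_of_isHomogeneous_zero hN h1]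
      exact h2
    · refine ⟨0, ((p : ℤ) - q).natAbs + 1, fun N hN => ?_⟩
      rw [gaugeAverage_of_isHomogeneous (by omega) hN h1, map_zero]
      exact zero_mem _
  | zero =>
    refine ⟨0, 0, fun N _ => ?_⟩
    rw [← zero_smul ℂ (0 : Fock d →L[ℂ] Fock d), gaugeAverage_smul, zero_smul, map_zero]
    exact zero_mem _
  | add x y _ _ hx hy =>
    obtain ⟨n, N, h⟩ := hx
    obtain ⟨n', N', h'⟩ := hy
    refine ⟨max n n', max N N', fun M hM => ?_⟩
    rw [gaugeAverage_add, map_add]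
    exact add_mem
      (isCuntz_calkinShift.level_mono hC (le_max_left n n') (h M (le_of_max_le_left hM)))
      (isCuntz_calkinShift.level_mono hC (le_max_right n n') (h' M (le_of_max_le_right hM)))
  | smul r x _ hx =>
    obtain ⟨n, N, h⟩ := hx
    refine ⟨n, N, fun M hM => ?_⟩
    rw [gaugeAverage_smul, map_smul]
    exact StarSubalgebra.smul_mem _ (h M hM) r

theorem coe_qD (hA : Z.ConditionA 1) (hS : ∀ i, shift i ∈ Z.toeplitz) :
    (Z.qD : Set (Calkin (Fock d))) =
      closure (⋃ n, (isCuntz_calkinShift.level (StarAlgebra.elemental ℂ Z.z) n : Set _)) := by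
  apply subset_antisymm
  · rintro _ ⟨X, hX, rfl⟩
    obtain ⟨hXT, hXg⟩ := mem_gaugeFixed.1 hX
    refine Metric.mem_closure_iff.2 fun ε hε => ?_
    obtain ⟨Y, hY, hXY⟩ := Metric.mem_closure_iff.1
      (show X ∈ closure (StarAlgebra.adjoin ℂ (Set.range Z.weightedShift) : Set _) from hXT) ε hε
    obtain ⟨n, N, hN⟩ := exists_gaugeAverage_mem_level hA hY
    -- The average over `N + 1 > 0` points fixes `X` and is contractive, so averaging `Y` does not
    -- worsen the approximation.
    refine ⟨_, Set.mem_iUnion.2 ⟨n, hN (N + 1) N.le_succ⟩, ?_⟩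
    change dist (calkinMap (Fock d) X) _ < ε
    rw [dist_eq_norm] at hXY ⊢
    rw [← map_sub]
    refine (NonUnitalStarAlgHom.norm_apply_le _ _).trans_lt (lt_of_le_of_lt ?_ hXY)
    have : X - gaugeAverage (N + 1) Y = gaugeAverage (N + 1) (X - Y) := by
      rw [sub_eq_add_neg X Y, ← neg_one_smul ℂ Y, gaugeAverage_add, gaugeAverage_smul,
        gaugeAverage_of_isHomogeneous_zero N.succ_pos hXg, neg_one_smul, ← sub_eq_add_neg]
    rw [this]
    exact norm_gaugeAverage_le _ _
  · exact closure_minimal (Set.iUnion_subset fun n => level_le_qD hS n) isClosed_qD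

end WeightSequence

/-! ### Positive weights: the shifts belong to the Toeplitz algebra -/

section PositiveWeights

section Positive

variable {A : Type*} [CStarAlgebra A] [PartialOrder A] [StarOrderedRing A]

theorem ofReal_smul_one_mono {r t : ℝ} (h : r ≤ t) : (r : ℂ) • (1 : A) ≤ (t : ℂ) • 1 := by
  rw [Complex.coe_smul, Complex.coe_smul]
  exact smul_le_smul_of_nonneg_right h zero_le_one

/-- From `δ ≤ a ≤ M` follows `0 ≤ 1 - a/M ≤ 1 - δ/M`. -/
theorem norm_one_sub_inv_smul_le {a : A} (ha : 0 ≤ a) {M δ : ℝ} (hM : 0 < M) (hδ : δ / M ≤ 1)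
    (h : ‖a‖ ≤ M) (h' : (δ : ℂ) • 1 ≤ a) : ‖1 - (M⁻¹ : ℂ) • a‖ ≤ 1 - δ / M := by
  rw [Complex.coe_smul] at h'
  rw [← Complex.ofReal_inv, Complex.coe_smul]
  have hup : a ≤ M • 1 := by
    have h1 := (IsSelfAdjoint.of_nonneg ha).le_algebraMap_norm_self
    rw [Algebra.algebraMap_eq_smul_one] at h1
    exact h1.trans (smul_le_smul_of_nonneg_right h zero_le_one)
  have h1 : 0 ≤ 1 - M⁻¹ • a := by
    rw [sub_nonneg]
    have := smul_le_smul_of_nonneg_left hup (inv_nonneg.2 hM.le)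
    rwa [smul_smul, inv_mul_cancel₀ hM.ne', one_smul] at this
  have h2 : 1 - M⁻¹ • a ≤ algebraMap ℝ A (1 - δ / M) := by
    have := smul_le_smul_of_nonneg_left h' (inv_nonneg.2 hM.le)
    rw [Algebra.algebraMap_eq_smul_one, sub_smul, one_smul]
    refine sub_le_sub_left ?_ _
    rwa [smul_smul, inv_mul_eq_div] at this
  exact (CStarAlgebra.norm_le_iff_le_algebraMap _ (sub_nonneg.2 hδ) h1).2 h2

/-- `a` is the square root of `a * a`, and a closed *-subalgebra is stable under the functional
calculus. -/
theorem mem_of_mul_self_mem {S : StarSubalgebra ℂ A} (hS : IsClosed (S : Set A)) {a : A}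
    (ha : 0 ≤ a) (h : a * a ∈ S) : a ∈ S := by
  rw [← CFC.sqrt_mul_self a ha, CFC.sqrt_eq_real_sqrt _ (ha.isSelfAdjoint.mul_self_nonneg)]
  exact cfcₙ_mem _ h

end Positive

variable {d : ℕ}

theorem diagonal_nonneg {A : ∀ k, Level d k →L[ℂ] Level d k} (hA : ∃ C : ℝ, ∀ k, ‖A k‖ ≤ C)
    (h : ∀ k, 0 ≤ A k) : 0 ≤ diagonal A hA := by
  rw [ContinuousLinearMap.nonneg_iff_isPositive, ContinuousLinearMap.isPositive_iff_complex]
  intro ξ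
  have h0 : ∀ k, 0 ≤ inner ℂ (A k (ξ k)) (ξ k) := fun k => by
    have := (ContinuousLinearMap.nonneg_iff_isPositive (A k)).1 (h k)
    exact this.inner_nonneg_left (ξ k)
  have : 0 ≤ inner ℂ (diagonal A hA ξ) ξ := by
    rw [lp.inner_eq_tsum]
    exact tsum_nonneg h0
  rw [Complex.nonneg_iff] at this
  refine ⟨Complex.ext rfl this.2, this.1⟩

namespace WeightSequence

variable {Z : WeightSequence d}

theorem exists_norm_one_sub_weight_lt (h0 : ∀ k, 0 ≤ Z.op k) :
    ∃ M : ℝ, 0 < M ∧ ‖1 - (M⁻¹ : ℂ) • Z.weight‖ < 1 := by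
  obtain ⟨c, hc⟩ := Z.bounded
  obtain ⟨ε, hε, hb⟩ := Z.bounded_below
  -- The lower bound `ε` is given only for `k ≥ 1`; at level 0 the operator is 1, so `δ = min ε 1`
  -- is a lower bound on every level. Taking `M ≥ 1` ensures `M > 0` and `δ / M ≤ 1`.
  have hM : 1 ≤ max c 1 := le_max_right _ _
  have hM0 : 0 < max c 1 := by linarith
  have hδ : 0 < min ε 1 := by positivity
  have hδ1 : min ε 1 ≤ 1 := min_le_right _ _
  refine ⟨max c 1, hM0, ?_⟩
  set M := max c 1
  set δ := min ε 1
  have hδM : δ / M ≤ 1 := (div_le_one hM0).2 (hδ1.trans hM)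
  have hR : ∀ k, ‖1 - (M⁻¹ : ℂ) • Z.op k‖ ≤ 1 - δ / M := by
    intro k
    refine norm_one_sub_inv_smul_le (h0 k) hM0 hδM ((hc k).trans (le_max_left _ _)) ?_
    rcases k.eq_zero_or_pos with rfl | hk
    · refine (ofReal_smul_one_mono hδ1).trans_eq ?_
      rw [Z.op_zero, Complex.ofReal_one, one_smul]
    · refine (ofReal_smul_one_mono (min_le_left ε 1)).trans ?_
      rw [← CFC.abs_of_nonneg _ (h0 k)]
      refine le_trans (le_of_eq ?_) (hb k hk)
      ext ξ
      simp
  have : 1 - (M⁻¹ : ℂ) • Z.weight = diagonal _ ⟨_, hR⟩ := by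
    refine clm_fock_ext fun ξ k => ?_
    rfl
  rw [this]
  refine (norm_diagonal_le _ hR).trans_lt ?_
  have := div_pos hδ hM0
  linarith

/-- With `R = 1 - Z/M` of norm less than 1, the Neumann series for the inverse of `Z` gives `Sᵢ =
M⁻¹ ∑ Rⁿ Wᵢ`. The summands must be placed in `𝒯` before `Z` is known to lie there. -/
theorem shift_mem_toeplitz_of_nonneg (h0 : ∀ k, 0 ≤ Z.op k) (i : Fin d) :
    shift i ∈ Z.toeplitz := by
  obtain ⟨M, hM, hR⟩ := exists_norm_one_sub_weight_lt h0
  set R := 1 - (M⁻¹ : ℂ) • Z.weight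
  have hZ : star Z.weight = Z.weight := (IsSelfAdjoint.of_nonneg (diagonal_nonneg Z.bounded h0))
  have hV : vacuumProjection d * Z.weight = vacuumProjection d := by
    refine clm_fock_ext fun ξ k => ?_
    change (if k = 0 then (1 : Level d k →L[ℂ] Level d k) else 0) (Z.op k (ξ k)) =
      (if k = 0 then (1 : Level d k →L[ℂ] Level d k) else 0) (ξ k)
    split_ifs with h
    · subst h; rw [Z.op_zero]; rfl
    · rfl
  have hVV : vacuumProjection d * vacuumProjection d = vacuumProjection d := by
    refine clm_fock_ext fun ξ k => ?_
    change (if k = 0 then (1 : Level d k →L[ℂ] Level d k) else 0)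
      ((if k = 0 then (1 : Level d k →L[ℂ] Level d k) else 0) (ξ k)) =
      (if k = 0 then (1 : Level d k →L[ℂ] Level d k) else 0) (ξ k)
    split_ifs <;> rfl
  have hVS : vacuumProjection d * shift i = 0 := by
    refine clm_fock_ext fun ξ k => ?_
    change (if k = 0 then (1 : Level d k →L[ℂ] Level d k) else 0) (shift i ξ k) = 0
    split_ifs with h
    · subst h; rfl
    · rfl
  have hC0 : 0 ≤ Z.weight - vacuumProjection d := by
    have hB : ∃ C : ℝ, ∀ k, ‖if k = 0 then (0 : Level d k →L[ℂ] Level d k) else Z.op k‖ ≤ C := by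
      obtain ⟨c, hc⟩ := Z.bounded
      refine ⟨c, fun k => ?_⟩
      split_ifs
      · rw [norm_zero]; exact (norm_nonneg _).trans (hc 0)
      · exact hc k
    have : Z.weight - vacuumProjection d = diagonal _ hB := by
      refine clm_fock_ext fun ξ k => ?_
      change Z.op k (ξ k) - (if k = 0 then (1 : Level d k →L[ℂ] Level d k) else 0) (ξ k) =
        (if k = 0 then (0 : Level d k →L[ℂ] Level d k) else Z.op k) (ξ k)
      split_ifs with h
      · subst h; rw [Z.op_zero]; exact sub_self _
      · exact sub_zero _
    rw [this]
    refine diagonal_nonneg hB fun k => ?_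
    split_ifs
    · exact le_rfl
    · exact h0 k
  have hC : Z.weight - vacuumProjection d ∈ Z.toeplitz := by
    -- The sum is `Z(1 - P₀)Z`, and `Z` acts as the identity on the vacuum. A square root then
    -- yields `Z - P₀`, without yielding `Z` itself.
    have hsq : ∑ j, Z.weightedShift j * star (Z.weightedShift j) =
        (Z.weight - vacuumProjection d) * (Z.weight - vacuumProjection d) := by
      have : ∀ j, Z.weightedShift j * star (Z.weightedShift j) =
          Z.weight * (shift j * star (shift j)) * Z.weight := fun j => by
        rw [weightedShift, star_mul, hZ]
        simp only [mul_assoc]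
      simp only [this]
      rw [← Finset.sum_mul, ← Finset.mul_sum, sum_shift_mul_star]
      simp only [mul_sub, sub_mul, mul_one, weight_mul_vacuumProjection, hV, hVV]
      abel
    have hmem : ∑ j, Z.weightedShift j * star (Z.weightedShift j) ∈ Z.toeplitz :=
      sum_mem fun j _ => mul_mem (weightedShift_mem_toeplitz j)
        (star_mem (weightedShift_mem_toeplitz j))
    exact mem_of_mul_self_mem isClosed_toeplitz hC0 (hsq ▸ hmem)
  -- On operators `V` with `P₀V = 0`, `Z` may be replaced by `Z - P₀ ∈ 𝒯`. The condition `P₀V = 0`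
  -- is inherited by `RV`, which allows iteration from `Wᵢ`.
  have hRN : ∀ V, V ∈ Z.toeplitz → vacuumProjection d * V = 0 →
      R * V ∈ Z.toeplitz ∧ vacuumProjection d * (R * V) = 0 := fun V hVT hV0 => by
    have h1 : R * V = V - (M⁻¹ : ℂ) • ((Z.weight - vacuumProjection d) * V) := by
      rw [sub_mul Z.weight, hV0, sub_zero, sub_mul, one_mul, smul_mul_assoc]
    refine ⟨?_, ?_⟩
    · rw [h1]
      exact sub_mem hVT (StarSubalgebra.smul_mem _ (mul_mem hC hVT) _)
    · rw [sub_mul, one_mul, smul_mul_assoc, mul_sub, mul_smul_comm, ← mul_assoc, hV, hV0,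
        smul_zero, sub_zero]
  have hRW : ∀ n, R ^ n * Z.weightedShift i ∈ Z.toeplitz ∧
      vacuumProjection d * (R ^ n * Z.weightedShift i) = 0 := fun n => by
    induction n with
    | zero =>
      rw [pow_zero, one_mul, weightedShift, ← mul_assoc, hV]
      exact ⟨weightedShift_mem_toeplitz i, hVS⟩
    | succ n ih =>
      rw [pow_succ', mul_assoc]
      exact hRN _ ih.1 ih.2
  -- These are the partial sums of the series, since `(1 - R)Sᵢ = M⁻¹ Wᵢ`.
  have hpart : ∀ n, shift i - R ^ n * shift i ∈ Z.toeplitz := fun n => by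
    induction n with
    | zero => simp
    | succ n ih =>
      have : shift i - R ^ (n + 1) * shift i =
          (shift i - R ^ n * shift i) + (M⁻¹ : ℂ) • (R ^ n * Z.weightedShift i) := by
        have hRS : R * shift i = shift i - (M⁻¹ : ℂ) • Z.weightedShift i := by
          rw [sub_mul, one_mul, smul_mul_assoc, weightedShift]
        rw [pow_succ, mul_assoc, hRS, mul_sub, mul_smul_comm]
        abel
      rw [this]
      exact add_mem ih (StarSubalgebra.smul_mem _ (hRW n).1 _)
  have hlim : Tendsto (fun n => shift i - R ^ n * shift i) atTop (𝓝 (shift i)) := by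
    have := (tendsto_pow_atTop_nhds_zero_of_norm_lt_one hR).mul_const (shift i)
    simpa using this.const_sub (shift i)
  exact isClosed_toeplitz.mem_of_tendsto hlim (Eventually.of_forall hpart)

end WeightSequence

end PositiveWeights

end WeightedCuntz

end

/-! ### The main theorem -/

theorem mainTheorem8 (d : ℕ) (hd : 0 < d) (Z : WeightedCuntz.WeightSequence d)
    (hA : Z.ConditionA 1)
    (hZ : (∀ k, 0 ≤ Z.op k) ∨ ∀ i, WeightedCuntz.shift i ∈ Z.toeplitz) :
    Nonempty (Z.qD ≃⋆ₐ[ℂ]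
      WeightedCuntz.CStarTensor (WeightedCuntz.UHF d) (StarAlgebra.elemental ℂ Z.z)) ∧
      ∀ J : TwoSidedIdeal Z.qD, IsClosed (J : Set Z.qD) → Z.IsInvariant J := by
  have hS : ∀ i, WeightedCuntz.shift i ∈ Z.toeplitz :=
    hZ.elim WeightedCuntz.WeightSequence.shift_mem_toeplitz_of_nonneg id
  have hC := WeightedCuntz.WeightSequence.commute_calkinShift hA
  have hL := WeightedCuntz.WeightSequence.coe_qD hA hS
  have hs := WeightedCuntz.isCuntz_calkinShift (d := d)
  have := StarAlgebra.elemental.isClosed ℂ Z.z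
  refine ⟨hs.nonempty_starAlgEquiv hC Z.qD hL, fun J hJ x hx y hy a ha => ?_⟩
  exact hs.star_mul_mul_mem_ideal hC hL hJ
    (WeightedCuntz.WeightSequence.star_calkinShift_mul_mem_qD hS hx)
    (WeightedCuntz.WeightSequence.star_calkinShift_mul_mem_qD hS hy) ⟨a, ha, rfl⟩
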